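/- Let $n\ge 1$ and $-\frac1n<\alpha<0$, and let $\mathcal P_1(\mathbb R^n)$ be the set of Borel probability measures on $\mathbb R^n$ with finite first moment. Let $\mu\in\mathcal P_1(\mathbb R^n)$ have barycenter $0$, and suppose that the support of $\mu$ is not contained in any affine hyperplane. For $\varrho\in\mathcal P_1(\mathbb R^n)$ with Lebesgue decomposition $\varrho=\rho\,dx+\varrho^s$ put $$\mathcal F_\alpha(\varrho)=-\int_{\mathbb R^n}\rho(x)^{\frac1{1-\alpha}}\,dx,\qquad \mathcal T(\varrho,\mu)=\sup_{\pi\in\Pi(\varrho,\mu)}\int_{\mathbb R^n\times\mathbb R^n}\langle x,y\rangle\,d\pi(x,y)\in[0,+\infty],$$ where $\Pi(\varrho,\mu)$ is the set of measures on $\mathbb R^n\times\mathbb R^n$ with marginals $\varrho$ and $\mu$, and a plan $\pi$ for which the positive and the negative part of $\langle x,y\rangle$ both have infinite integral does not contribute to the supremum. Let $\varrho_0\in\mathcal P_1(\mathbb R^n)$ be a minimizer of $$\inf\big\{(1-\alpha)\mathcal F_\alpha(\varrho)-\alpha\,\mathcal T(\varrho,\mu):\ \varrho\in\mathcal P_1(\mathbb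 R^n)\big\}.$$ Then there are a proper, convex, lower semicontinuous function $\varphi_0:\mathbb R^n\to[\frac1\alpha,+\infty]$ and a measure $\varrho_0^s$ that is mutually singular with Lebesgue measure, such that $$\varrho_0=(1-\alpha\varphi_0)^{\frac1\alpha-1}\,dx+\varrho_0^s,\qquad \operatorname{supp}(\varrho_0^s)\subset\Big\{\varphi_0=\frac1\alpha\Big\},$$ where the density is $0$ where $\varphi_0=+\infty$ and $+\infty$ where $\varphi_0=\frac1\alpha$. Moreover, with the Legendre transform $\varphi_0^*(y)=\sup_{x}\{\langle x,y\rangle-\varphi_0(x)\}$, the integrals $\int\varphi_0\,d\varrho_0$ and $\int\varphi_0^*\,d\mu$ are finite and $$\mathcal T(\varrho_0,\mu)=\int_{\mathbb R^n}\varphi_0\,d\varrho_0+\int_{\mathbb R^n}\varphi_0^*\,d\mu .$$ -/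

import Mathlib

open MeasureTheory

noncomputable section

namespace AlphaConcave

/-- The Euclidean space of dimension `n`. -/
abbrev Space (n : ℕ) : Type := EuclideanSpace ℝ (Fin n)

/-- Integral of an extended-real function, the integral of its positive part minus the integral
of its negative part. It is a real number exactly when both parts have a finite integral.
If both are infinite the value is `⊥` (the convention `⊤ - ⊤ = ⊥`). -/
def eintegral {X : Type*} [MeasurableSpace X] (m : Measure X) (f : X → EReal) : EReal :=
  ((∫⁻ x, (f x).toENNReal ∂m : ENNReal) : EReal) - ((∫⁻ x, (-f x).toENNReal ∂m : ENNReal) : EReal)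

/-- Borel probability measures with finite first moment. -/
def FiniteFirstMoment (n : ℕ) : Set (Measure (Space n)) :=
  {ϱ | IsProbabilityMeasure ϱ ∧ ∫⁻ x, ‖x‖ₑ ∂ϱ < ⊤}

/-- Proper, convex, lower semicontinuous functions with values in `ℝ ∪ {+∞}`. -/
structure IsConv {n : ℕ} (φ : Space n → EReal) : Prop where
  ne_bot : ∀ x, φ x ≠ ⊥
  proper : ∃ x, φ x < ⊤
  convex : ∀ x y : Space n, ∀ t : ℝ, 0 ≤ t → t ≤ 1 →
    φ (t • x + (1 - t) • y) ≤ (t : EReal) * φ x + ((1 - t : ℝ) : EReal) * φ y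
  lsc : LowerSemicontinuous φ

/-- Legendre transform. -/
def legendre {n : ℕ} (φ : Space n → EReal) (y : Space n) : EReal :=
  ⨆ x : Space n, ((inner ℝ x y : ℝ) : EReal) - φ x

/-- Transference plans (couplings) between two measures. -/
def plans {n : ℕ} (ϱ μ : Measure (Space n)) : Set (Measure (Space n × Space n)) :=
  {π | π.map Prod.fst = ϱ ∧ π.map Prod.snd = μ}

/-- Maximal correlation functional: the supremum of the integral of `⟨x, y⟩` over all transference
plans. A plan for which the integral is undefined has the value `⊥` and so does not contribute. -/
def maxCorr {n : ℕ} (ϱ μ : Measure (Space n)) : EReal :=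
  ⨆ π ∈ plans ϱ μ, eintegral π (fun p => ((inner ℝ p.1 p.2 : ℝ) : EReal))

/-- The functional `-∫ ρ ^ (1 / (1 - α)) dx`, with `ρ` the density of the absolutely continuous
part of `ϱ` in its Lebesgue decomposition. -/
def energy {n : ℕ} (α : ℝ) (ϱ : Measure (Space n)) : EReal :=
  -((∫⁻ x, (ϱ.rnDeriv volume x) ^ (1 / (1 - α)) : ENNReal) : EReal)

/-- The functional that is minimised over the probability measures with finite first moment. -/
def objective {n : ℕ} (α : ℝ) (μ ϱ : Measure (Space n)) : EReal :=
  ((1 - α : ℝ) : EReal) * energy α ϱ - (α : EReal) * maxCorr ϱ μ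

/-- The density `(1 - α φ) ^ (1 / α - 1)` for `α < 0` and `φ ≥ 1 / α`; it is `⊤` where
`φ = 1 / α` and `0` where `φ = ⊤`. -/
def density {n : ℕ} (α : ℝ) (φ : Space n → EReal) (x : Space n) : ENNReal :=
  (1 - (α : EReal) * φ x).toENNReal ^ (1 / α - 1)

end AlphaConcave

end

/-! Kantorovich duality linearises the transport term. A coupling of `ϱ₀` and `μ` concentrated on a
cyclically monotone set has a Rockafellar potential `φ`, and `φ` turns the duality inequality into
an equality at `ϱ₀` (`exists_potential`). With the same `φ`, weak duality bounds `maxCorr ϱ μ` from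
above for every other `ϱ` that integrates `φ`. Hence `ϱ₀` also minimises the functional in which `∫
φ dϱ + ∫ φ* dμ` replaces the maximal correlation (`linearized_objective_le`).

Let `ρ` be the density of `ϱ₀`, `m = 1 / (1 - α)` and `E = ∫ ρ ^ m`. The assumption `α > -1/n` makes
`E` finite. Moving from `ϱ₀` towards a probability measure `η` and letting the step tend to `0`
gives `∫ ρ ^ (m - 1) dη_ac ≤ E - α (∫ φ dη - ∫ φ dϱ₀)` (`first_variation`). The additive constant of
`φ` is free; choosing `α ∫ φ dϱ₀ = 1 - E` turns the right side into `∫ (1 - α φ) dη`. Dirac masses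
then give `φ ≥ 1/α`, and uniform distributions give `ρ ^ (m - 1) ≤ 1 - α φ` almost everywhere.

The same normalisation says `∫ (1 - α φ) dϱ₀ = E = ∫ ρ ^ m`. So there is no slack: `ρ ^ (m - 1) = 1
- α φ` where `ρ > 0`, and `1 - α φ` vanishes almost everywhere for the singular part
(`euler_lagrange`). Since `m - 1` is the inverse of `1/α - 1`, this is the stated density. -/

noncomputable section

namespace AlphaConcave

open Filter Topology

/-! ### Cyclic monotonicity and Rockafellar's potential -/

variable {E : Type*} [NormedAddCommGroup E] [InnerProductSpace ℝ E]

/-- A set of pairs is cyclically monotone if no permutation of the first components of finitely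
many of its pairs increases the sum of the inner products. -/
def IsCyclicallyMonotone (Γ : Set (E × E)) : Prop :=
  ∀ (N : ℕ) (p : Fin N → E × E), (∀ i, p i ∈ Γ) → ∀ σ : Equiv.Perm (Fin N),
    ∑ i, (inner ℝ (p (σ i)).1 (p i).2 : ℝ) ≤ ∑ i, (inner ℝ (p i).1 (p i).2 : ℝ)

/-- The supremum of the affine functions `x ↦ ⟨x, s.1⟩ + s.2` with `s ∈ S`. -/
def supAffine (S : Set (E × ℝ)) (x : E) : EReal :=
  ⨆ s : S, ((inner ℝ x s.1.1 + s.1.2 : ℝ) : EReal)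

theorem le_supAffine {S : Set (E × ℝ)} {s : E × ℝ} (hs : s ∈ S) (x : E) :
    ((inner ℝ x s.1 + s.2 : ℝ) : EReal) ≤ supAffine S x :=
  le_iSup (fun s : S => ((inner ℝ x s.1.1 + s.1.2 : ℝ) : EReal)) ⟨s, hs⟩

theorem supAffine_ne_bot {S : Set (E × ℝ)} (hS : S.Nonempty) (x : E) : supAffine S x ≠ ⊥ := by
  obtain ⟨s, hs⟩ := hS
  exact ne_bot_of_le_ne_bot (EReal.coe_ne_bot _) (le_supAffine hs x)

theorem lowerSemicontinuous_supAffine (S : Set (E × ℝ)) : LowerSemicontinuous (supAffine S) := by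
  refine lowerSemicontinuous_iSup fun s => Continuous.lowerSemicontinuous ?_
  exact continuous_coe_real_ereal.comp (by fun_prop)

theorem supAffine_convex (S : Set (E × ℝ)) (x y : E) (t : ℝ) (h0 : 0 ≤ t) (h1 : t ≤ 1) :
    supAffine S (t • x + (1 - t) • y) ≤
      (t : EReal) * supAffine S x + ((1 - t : ℝ) : EReal) * supAffine S y := by
  refine iSup_le fun s => ?_
  have h : (inner ℝ (t • x + (1 - t) • y) s.1.1 + s.1.2 : ℝ) =
      t * (inner ℝ x s.1.1 + s.1.2) + (1 - t) * (inner ℝ y s.1.1 + s.1.2) := by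
    rw [inner_add_left, real_inner_smul_left, real_inner_smul_left]; ring
  rw [h, EReal.coe_add, EReal.coe_mul, EReal.coe_mul]
  exact add_le_add
    (mul_le_mul_of_nonneg_left (le_supAffine s.2 x) (EReal.coe_nonneg.2 h0))
    (mul_le_mul_of_nonneg_left (le_supAffine s.2 y) (EReal.coe_nonneg.2 (sub_nonneg.2 h1)))

theorem isConv_supAffine {n : ℕ} {S : Set (Space n × ℝ)} (hS : S.Nonempty)
    (hp : ∃ x, supAffine S x < ⊤) : IsConv (supAffine S) where
  ne_bot := supAffine_ne_bot hS
  proper := hp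
  convex := supAffine_convex S
  lsc := lowerSemicontinuous_supAffine S

/-- Adding a constant to a supremum of affine functions. -/
theorem supAffine_image_add (S : Set (E × ℝ)) (k : ℝ) (x : E) :
    supAffine ((fun s : E × ℝ => (s.1, s.2 + k)) '' S) x = supAffine S x + k := by
  apply le_antisymm
  · refine iSup_le ?_
    rintro ⟨_, s, hs, rfl⟩
    have := add_le_add_left (le_supAffine hs x) (k : EReal)
    rwa [← EReal.coe_add, add_assoc] at this
  · refine EReal.add_le_of_le_sub (iSup_le fun s => ?_)
    refine EReal.le_sub_iff_add_le (by simp) (by simp) |>.2 ?_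
    have := le_supAffine (Set.mem_image_of_mem (fun s : E × ℝ => (s.1, s.2 + k)) s.2) x
    rwa [← add_assoc, EReal.coe_add] at this

/-- The affine functions whose supremum is Rockafellar's potential of `Γ` with base point `p₀`. -/
def chainFamily (Γ : Set (E × E)) (p₀ : E × E) : Set (E × ℝ) :=
  {s | ∃ (N : ℕ) (p : ℕ → E × E), (∀ i, p i ∈ Γ) ∧ p 0 = p₀ ∧
    s = ((p N).2, ∑ i ∈ Finset.range N, inner ℝ (p (i + 1)).1 (p i).2
      - ∑ i ∈ Finset.range (N + 1), inner ℝ (p i).1 (p i).2)}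

/-- Evaluating at the base point closes the chain into a cycle, and cyclic monotonicity applies to
the cyclic shift `finRotate`. -/
theorem chainFamily_le_zero {Γ : Set (E × E)} (hΓ : IsCyclicallyMonotone Γ) {p₀ : E × E}
    {s : E × ℝ} (hs : s ∈ chainFamily Γ p₀) : inner ℝ p₀.1 s.1 + s.2 ≤ 0 := by
  obtain ⟨N, p, hp, rfl, rfl⟩ := hs
  have h := hΓ (N + 1) (fun i => p i) (fun i => hp i) (finRotate (N + 1))
  rw [Fin.sum_univ_castSucc] at h
  simp only [finRotate_last, Fin.val_zero, Fin.val_last, Fin.val_castSucc] at h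
  have e : ∀ i : Fin N, ((finRotate (N + 1) i.castSucc : Fin (N + 1)) : ℕ) = i + 1 := by
    intro i
    rw [coe_finRotate_of_ne_last (Fin.castSucc_lt_last i).ne]; simp
  simp only [e] at h
  rw [Fin.sum_univ_eq_sum_range (fun i => (inner ℝ (p (i + 1)).1 (p i).2 : ℝ)) N,
    Fin.sum_univ_eq_sum_range (fun i => (inner ℝ (p i).1 (p i).2 : ℝ)) (N + 1)] at h
  simp only
  linarith

/-- A chain can be prolonged by `q`. The new affine function has slope `q.2` and agrees with the old
one at `q.1`, which is the source of the subgradient inequality at `q`. -/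
theorem chainFamily_step {Γ : Set (E × E)} {p₀ : E × E} {s : E × ℝ} (hs : s ∈ chainFamily Γ p₀)
    {q : E × E} (hq : q ∈ Γ) :
    (q.2, inner ℝ q.1 s.1 + s.2 - inner ℝ q.1 q.2) ∈ chainFamily Γ p₀ := by
  obtain ⟨N, p, hp, rfl, rfl⟩ := hs
  refine ⟨N + 1, fun i => if i ≤ N then p i else q, fun i => ?_, by simp, ?_⟩
  · dsimp only; split_ifs <;> simp [hp, hq]
  · have h1 : ∑ i ∈ Finset.range N, (inner ℝ (if i + 1 ≤ N then p (i + 1) else q).1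
        (if i ≤ N then p i else q).2 : ℝ) = ∑ i ∈ Finset.range N, inner ℝ (p (i + 1)).1 (p i).2 := by
      refine Finset.sum_congr rfl fun i hi => ?_
      rw [Finset.mem_range] at hi
      rw [if_pos (by omega), if_pos hi.le]
    have h2 : ∑ i ∈ Finset.range (N + 1), (inner ℝ (if i ≤ N then p i else q).1
        (if i ≤ N then p i else q).2 : ℝ) = ∑ i ∈ Finset.range (N + 1), inner ℝ (p i).1 (p i).2 := by
      refine Finset.sum_congr rfl fun i hi => ?_
      rw [Finset.mem_range] at hi
      rw [if_pos (by omega)]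
    simp only
    rw [Finset.sum_range_succ (fun i => inner ℝ (if i + 1 ≤ N then p (i + 1) else q).1
      (if i ≤ N then p i else q).2) N, Finset.sum_range_succ _ (N + 1), h1, h2]
    simp only [Nat.not_succ_le_self, if_false, le_refl, if_true]
    rw [Prod.mk.injEq]
    exact ⟨rfl, by ring⟩

/-- **Rockafellar's theorem**: a cyclically monotone set lies in the graph of the subdifferential
of a supremum of affine functions. -/
theorem exists_supAffine_of_isCyclicallyMonotone {Γ : Set (E × E)} (hΓ : IsCyclicallyMonotone Γ)
    (hne : Γ.Nonempty) : ∃ S : Set (E × ℝ), S.Nonempty ∧ ∀ p ∈ Γ, ∃ a : ℝ,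
      supAffine S p.1 = a ∧ ∀ z, ((a + inner ℝ (z - p.1) p.2 : ℝ) : EReal) ≤ supAffine S z := by
  obtain ⟨p₀, hp₀⟩ := hne
  have hS : (chainFamily Γ p₀).Nonempty := ⟨_, 0, fun _ => p₀, fun _ => hp₀, rfl, rfl⟩
  refine ⟨chainFamily Γ p₀, hS, fun p hp => ?_⟩
  have key : ∀ s ∈ chainFamily Γ p₀, ∀ z, ((inner ℝ p.1 s.1 + s.2 + inner ℝ (z - p.1) p.2 : ℝ) : EReal)
      ≤ supAffine (chainFamily Γ p₀) z := by
    intro s hs z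
    have h := le_supAffine (chainFamily_step hs hp) z
    convert h using 2
    simp only
    rw [inner_sub_left]; ring
  -- Every chain prolonged by `p` is at most `0` at the base point, and this bounds all chains at
  -- `p.1` uniformly.
  have htop : supAffine (chainFamily Γ p₀) p.1 ≤ ((- inner ℝ (p₀.1 - p.1) p.2 : ℝ) : EReal) := by
    refine iSup_le fun s => EReal.coe_le_coe_iff.2 ?_
    have h0 : supAffine (chainFamily Γ p₀) p₀.1 ≤ ((0 : ℝ) : EReal) :=
      iSup_le fun s => EReal.coe_le_coe_iff.2 (chainFamily_le_zero hΓ s.2)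
    have h1 := EReal.coe_le_coe_iff.1 ((key s.1 s.2 p₀.1).trans h0)
    linarith
  lift supAffine (chainFamily Γ p₀) p.1 to ℝ using
    ⟨ne_top_of_le_ne_top (EReal.coe_ne_top _) htop, supAffine_ne_bot hS _⟩ with a ha
  refine ⟨a, rfl, fun z => ?_⟩
  rw [EReal.coe_add]
  refine EReal.add_le_of_le_sub (ha.le.trans (iSup_le fun s => ?_))
  refine EReal.le_sub_iff_add_le (by simp) (by simp) |>.2 ?_
  rw [← EReal.coe_add]
  exact key s.1 s.2 z

/-! ### Optimal couplings on finite sets -/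

/-- The transport polytope with given marginals contains a matrix whose support is cyclically
monotone for the cost `c`. -/
theorem exists_optimal_matrix {ι κ : Type*} [Fintype ι] [Fintype κ] [DecidableEq ι] [DecidableEq κ]
    (a : ι → ℝ) (b : κ → ℝ) (ha : ∀ i, 0 ≤ a i) (hb : ∀ j, 0 ≤ b j) (ha1 : ∑ i, a i = 1)
    (hb1 : ∑ j, b j = 1) (c : ι × κ → ℝ) :
    ∃ w : ι × κ → ℝ, (∀ q, 0 ≤ w q) ∧ (∀ i, ∑ j, w (i, j) = a i) ∧ (∀ j, ∑ i, w (i, j) = b j) ∧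
      ∀ (N : ℕ) (q : Fin N → ι × κ), (∀ k, 0 < w (q k)) → ∀ σ : Equiv.Perm (Fin N),
        ∑ k, c ((q (σ k)).1, (q k).2) ≤ ∑ k, c (q k) := by
  let K : Set (ι × κ → ℝ) :=
    {w | (∀ q, 0 ≤ w q) ∧ (∀ i, ∑ j, w (i, j) = a i) ∧ (∀ j, ∑ i, w (i, j) = b j)}
  have hK : IsCompact K := by
    refine (isCompact_Icc (a := (0 : ι × κ → ℝ)) (b := fun q => a q.1)).of_isClosed_subset ?_ ?_
    · refine IsClosed.inter (s₁ := {w : ι × κ → ℝ | ∀ q, 0 ≤ w q}) ?_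
        (IsClosed.inter (s₁ := {w : ι × κ → ℝ | ∀ i, ∑ j, w (i, j) = a i}) ?_ ?_)
      · simp only [Set.ofPred_forall]
        exact isClosed_iInter fun q => isClosed_le continuous_const (continuous_apply q)
      · simp only [Set.ofPred_forall]
        exact isClosed_iInter fun q => isClosed_eq (by fun_prop) continuous_const
      · show IsClosed {w : ι × κ → ℝ | ∀ j, ∑ i, w (i, j) = b j}
        simp only [Set.ofPred_forall]
        exact isClosed_iInter fun q => isClosed_eq (by fun_prop) continuous_const
    · rintro w ⟨h0, h1, -⟩
      refine ⟨h0, fun q => ?_⟩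
      show w q ≤ a q.1
      rw [← h1 q.1]
      exact Finset.single_le_sum (f := fun j => w (q.1, j)) (fun j _ => h0 _) (Finset.mem_univ q.2)
  have hne : K.Nonempty := by
    refine ⟨fun q => a q.1 * b q.2, fun q => mul_nonneg (ha _) (hb _), fun i => ?_, fun j => ?_⟩
    · simp only [← Finset.mul_sum, hb1, mul_one]
    · simp only [← Finset.sum_mul, ha1, one_mul]
  -- A maximiser of the total correlation: if some rematching of charged entries were better,
  -- shifting a little mass along it would contradict maximality.
  obtain ⟨w, hw, hmax⟩ := hK.exists_isMaxOn hne
    (f := fun w : ι × κ → ℝ => ∑ q, w q * c q) (by fun_prop)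
  obtain ⟨h0, h1, h2⟩ := hw
  refine ⟨w, h0, h1, h2, fun N q hq σ => ?_⟩
  rcases Nat.eq_zero_or_pos N with rfl | hN
  · simp
  have : Nonempty (Fin N) := ⟨⟨0, hN⟩⟩
  obtain ⟨k₀, hk₀⟩ := Finite.exists_min (fun k => w (q k))
  have hN' : (0 : ℝ) < N := by exact_mod_cast hN
  -- An entry occurs at most `N` times among the `q k`, so removing mass `δ` per occurrence keeps
  -- `w` nonnegative.
  obtain ⟨δ, hδ, hδN⟩ : ∃ δ : ℝ, 0 < δ ∧ ∀ k, δ * N ≤ w (q k) :=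
    ⟨w (q k₀) / N, div_pos (hq _) hN', fun k => by rw [div_mul_cancel₀ _ hN'.ne']; exact hk₀ k⟩
  -- `u` and `v` count the occurrences of an entry among the rematched and the original pairs; they
  -- have the same row and column sums.
  let u : ι × κ → ℝ := fun r => ∑ k, if ((q (σ k)).1, (q k).2) = r then 1 else 0
  let v : ι × κ → ℝ := fun r => ∑ k, if q k = r then 1 else 0
  have hu : ∀ f : ι × κ → ℝ, ∑ r, u r * f r = ∑ k, f ((q (σ k)).1, (q k).2) := by
    intro f
    simp only [u, Finset.sum_mul]
    rw [Finset.sum_comm]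
    simp
  have hv : ∀ f : ι × κ → ℝ, ∑ r, v r * f r = ∑ k, f (q k) := by
    intro f
    simp only [v, Finset.sum_mul]
    rw [Finset.sum_comm]
    simp
  have hmem : (fun r => w r + δ * (u r - v r)) ∈ K := by
    refine ⟨fun r => ?_, fun i => ?_, fun j => ?_⟩
    · have hu0 : 0 ≤ u r := Finset.sum_nonneg fun k _ => by split_ifs <;> norm_num
      have hvr : δ * v r ≤ w r := by
        by_cases h : ∃ k, q k = r
        · obtain ⟨k, rfl⟩ := h
          refine le_trans (mul_le_mul_of_nonneg_left ?_ hδ.le) (hδN k)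
          calc v (q k) ≤ ∑ _k : Fin N, (1 : ℝ) :=
                Finset.sum_le_sum fun k _ => by split_ifs <;> norm_num
            _ = N := by simp
        · have : v r = 0 := Finset.sum_eq_zero fun k _ => if_neg fun hk => h ⟨k, hk⟩
          rw [this, mul_zero]; exact h0 r
      nlinarith [mul_nonneg hδ.le hu0]
    · have e1 : ∑ j, u (i, j) = ∑ k, if (q (σ k)).1 = i then 1 else 0 := by
        simp only [u]; rw [Finset.sum_comm]
        refine Finset.sum_congr rfl fun k _ => ?_
        by_cases h : (q (σ k)).1 = i <;> simp [h]
      have e2 : ∑ j, v (i, j) = ∑ k, if (q k).1 = i then 1 else 0 := by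
        simp only [v]; rw [Finset.sum_comm]
        refine Finset.sum_congr rfl fun k _ => ?_
        by_cases h : (q k).1 = i <;> simp [h, Prod.ext_iff]
      simp only [Finset.sum_add_distrib, ← Finset.mul_sum, Finset.sum_sub_distrib, e1, e2, h1]
      rw [Equiv.sum_comp σ (fun k => if (q k).1 = i then (1 : ℝ) else 0)]
      simp
    · have e1 : ∑ i, u (i, j) = ∑ k, if (q k).2 = j then 1 else 0 := by
        simp only [u]; rw [Finset.sum_comm]
        refine Finset.sum_congr rfl fun k _ => ?_
        by_cases h : (q k).2 = j <;> simp [h]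
      have e2 : ∑ i, v (i, j) = ∑ k, if (q k).2 = j then 1 else 0 := by
        simp only [v]; rw [Finset.sum_comm]
        refine Finset.sum_congr rfl fun k _ => ?_
        by_cases h : (q k).2 = j <;> simp [h, Prod.ext_iff]
      simp only [Finset.sum_add_distrib, ← Finset.mul_sum, Finset.sum_sub_distrib, e1, e2, h2]
      simp
  have h := hmax hmem
  simp only [Set.mem_ofPred_eq, add_mul, Finset.sum_add_distrib, mul_assoc, ← Finset.mul_sum,
    sub_mul, Finset.sum_sub_distrib, hu, hv] at h
  nlinarith

/-- Two probability measures on finite types have a coupling whose support is cyclically monotone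
for the cost `c`. -/
theorem exists_coupling_of_finite {ι κ : Type*} [Finite ι] [Finite κ]
    [MeasurableSpace ι] [MeasurableSpace κ] [MeasurableSingletonClass ι]
    [MeasurableSingletonClass κ] (ν : Measure ι) (ν' : Measure κ) [IsProbabilityMeasure ν]
    [IsProbabilityMeasure ν'] (c : ι × κ → ℝ) :
    ∃ ω : Measure (ι × κ), ω.map Prod.fst = ν ∧ ω.map Prod.snd = ν' ∧
      ∀ (N : ℕ) (q : Fin N → ι × κ), (∀ k, 0 < ω {q k}) → ∀ σ : Equiv.Perm (Fin N),
        ∑ k, c ((q (σ k)).1, (q k).2) ≤ ∑ k, c (q k) := by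
  classical
  have := Fintype.ofFinite ι
  have := Fintype.ofFinite κ
  obtain ⟨w, h0, h1, h2, h3⟩ := exists_optimal_matrix (fun i => ν.real {i}) (fun j => ν'.real {j})
    (fun _ => measureReal_nonneg) (fun _ => measureReal_nonneg)
    (by rw [sum_measureReal_singleton]; simp) (by rw [sum_measureReal_singleton]; simp) c
  let ω : Measure (ι × κ) := Measure.sum fun q => ENNReal.ofReal (w q) • Measure.dirac q
  have hω : ∀ A, ω A = ∑ q, if q ∈ A then ENNReal.ofReal (w q) else 0 := by
    intro A
    rw [Measure.sum_apply _ (Set.toFinite A).measurableSet, tsum_fintype]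
    refine Finset.sum_congr rfl fun q _ => ?_
    simp [Set.indicator_apply]
  refine ⟨ω, ?_, ?_, fun N q hq σ => h3 N q (fun k => ?_) σ⟩
  · refine Measure.ext_of_singleton fun i => ?_
    rw [Measure.map_apply measurable_fst (measurableSet_singleton i), hω, Fintype.sum_prod_type,
      ← ofReal_measureReal, ← h1, ENNReal.ofReal_sum_of_nonneg fun _ _ => h0 _]
    simp [Finset.sum_ite_irrel]
  · refine Measure.ext_of_singleton fun j => ?_
    rw [Measure.map_apply measurable_snd (measurableSet_singleton j), hω, Fintype.sum_prod_type,
      ← ofReal_measureReal, ← h2, ENNReal.ofReal_sum_of_nonneg fun _ _ => h0 _]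
    simp
  · have := hq k
    rw [hω] at this
    simpa using this

/-! ### Cyclically monotone couplings of probability measures -/

variable {n : ℕ}

/-- Laws of simple functions have a coupling that charges only a cyclically monotone set. -/
theorem exists_coupling_simpleFunc (ϱ μ : Measure (Space n)) [IsProbabilityMeasure ϱ]
    [IsProbabilityMeasure μ] (f g : SimpleFunc (Space n) (Space n)) :
    ∃ (π : Measure (Space n × Space n)) (Γ : Set (Space n × Space n)),
      π.map Prod.fst = ϱ.map f ∧ π.map Prod.snd = μ.map g ∧ IsCyclicallyMonotone Γ ∧
        ∀ U, MeasurableSet U → 0 < π U → (U ∩ Γ).Nonempty := by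
  have : Finite (Set.range f) := f.finite_range
  have : Finite (Set.range g) := g.finite_range
  have hf : Measurable (Set.rangeFactorization f) := f.measurable.subtype_mk
  have hg : Measurable (Set.rangeFactorization g) := g.measurable.subtype_mk
  have := Measure.isProbabilityMeasure_map hf.aemeasurable (μ := ϱ)
  have := Measure.isProbabilityMeasure_map hg.aemeasurable (μ := μ)
  obtain ⟨ω, h1, h2, h3⟩ := exists_coupling_of_finite (ϱ.map (Set.rangeFactorization f))
    (μ.map (Set.rangeFactorization g)) (fun q => inner ℝ q.1.1 q.2.1)
  let J : Set.range f × Set.range g → Space n × Space n := Prod.map Subtype.val Subtype.val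
  have hJ : Measurable J := measurable_subtype_coe.prodMap measurable_subtype_coe
  refine ⟨ω.map J, J '' {q | 0 < ω {q}}, ?_, ?_, ?_, ?_⟩
  · rw [Measure.map_map measurable_fst hJ]
    change ω.map (Subtype.val ∘ Prod.fst) = _
    rw [← Measure.map_map measurable_subtype_coe measurable_fst, h1,
      Measure.map_map measurable_subtype_coe hf]
    rfl
  · rw [Measure.map_map measurable_snd hJ]
    change ω.map (Subtype.val ∘ Prod.snd) = _
    rw [← Measure.map_map measurable_subtype_coe measurable_snd, h2,
      Measure.map_map measurable_subtype_coe hg]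
    rfl
  · intro N p hp σ
    choose q hq hqp using hp
    obtain rfl : (fun k => J (q k)) = p := funext hqp
    exact h3 N q hq σ
  · intro U hU hpos
    rw [Measure.map_apply hJ hU] at hpos
    by_contra hne
    refine hpos.ne' ?_
    rw [← Set.biUnion_of_singleton (J ⁻¹' U), measure_biUnion_null_iff (Set.to_countable _)]
    intro q hq
    by_contra hq0
    exact hne ⟨J q, hq, q, pos_iff_ne_zero.2 hq0, rfl⟩

/-- The laws of the canonical simple approximations of the identity. -/
theorem tendsto_map_approxOn (ϱ : ProbabilityMeasure (Space n)) :
    Tendsto (fun k => ϱ.map (f := SimpleFunc.approxOn (id : Space n → Space n) measurable_id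
      Set.univ 0 trivial k) (SimpleFunc.measurable _).aemeasurable) atTop (𝓝 ϱ) := by
  rw [ProbabilityMeasure.tendsto_iff_forall_integral_tendsto]
  intro f
  simp only [ProbabilityMeasure.toMeasure_map]
  have : ∀ k, ∫ x, f x ∂((ϱ : Measure (Space n)).map (SimpleFunc.approxOn (id : Space n → Space n)
      measurable_id Set.univ 0 trivial k)) = ∫ x, f (SimpleFunc.approxOn (id : Space n → Space n)
      measurable_id Set.univ 0 trivial k x) ∂(ϱ : Measure (Space n)) := fun k =>
    integral_map (SimpleFunc.measurable _).aemeasurable f.continuous.aestronglyMeasurable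
  simp only [this]
  refine tendsto_integral_of_dominated_convergence (fun _ => ‖f‖) (fun k => ?_)
    (integrable_const _) (fun k => Eventually.of_forall fun x => f.norm_coe_le_norm _)
    (Eventually.of_forall fun x => ?_)
  · exact (f.continuous.measurable.comp (SimpleFunc.measurable _)).aestronglyMeasurable
  · exact (f.continuous.tendsto _).comp
      (SimpleFunc.tendsto_approxOn measurable_id (s := Set.univ) trivial (by simp))

/-- Measures on a product whose marginals are images of fixed measures under maps that at most
double the norm are tight. -/
theorem isTightMeasureSet_of_marginals (ϱ μ : Measure (Space n)) [IsProbabilityMeasure ϱ]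
    [IsProbabilityMeasure μ] (f g : ℕ → Space n → Space n) (hf : ∀ k, Measurable (f k))
    (hg : ∀ k, Measurable (g k)) (hf2 : ∀ k x, ‖f k x‖ ≤ ‖x‖ + ‖x‖)
    (hg2 : ∀ k x, ‖g k x‖ ≤ ‖x‖ + ‖x‖) (π : ℕ → Measure (Space n × Space n))
    (h1 : ∀ k, (π k).map Prod.fst = ϱ.map (f k)) (h2 : ∀ k, (π k).map Prod.snd = μ.map (g k)) :
    IsTightMeasureSet (Set.range π) := by
  refine isTightMeasureSet_of_tendsto_measure_norm_gt ?_
  have hlim : ∀ ν : Measure (Space n), IsProbabilityMeasure ν →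
      Tendsto (fun r : ℝ => ν {x | r / 2 < ‖x‖}) atTop (𝓝 0) := by
    intro ν _
    have h := tendsto_measure_norm_gt_of_isTightMeasureSet (isTightMeasureSet_singleton (μ := ν))
    simp only [Set.mem_singleton_iff, iSup_iSup_eq_left] at h
    exact h.comp (tendsto_id.atTop_div_const (by norm_num))
  have hsum := (hlim ϱ inferInstance).add (hlim μ inferInstance)
  rw [add_zero] at hsum
  refine tendsto_of_tendsto_of_tendsto_of_le_of_le tendsto_const_nhds hsum (fun _ => zero_le)
    fun r => ?_
  simp only [iSup_range]
  refine iSup_le fun k => ?_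
  have hm : MeasurableSet {x : Space n | r < ‖x‖} := measurableSet_lt measurable_const measurable_norm
  calc π k {p | r < ‖p‖} ≤ π k (Prod.fst ⁻¹' {x | r < ‖x‖} ∪ Prod.snd ⁻¹' {x | r < ‖x‖}) := by
        refine measure_mono fun p hp => ?_
        simpa [Prod.norm_def] using hp
    _ ≤ π k (Prod.fst ⁻¹' {x | r < ‖x‖}) + π k (Prod.snd ⁻¹' {x | r < ‖x‖}) := measure_union_le _ _
    _ = ϱ ((f k) ⁻¹' {x | r < ‖x‖}) + μ ((g k) ⁻¹' {x | r < ‖x‖}) := by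
        rw [← Measure.map_apply measurable_fst hm, ← Measure.map_apply measurable_snd hm, h1, h2,
          Measure.map_apply (hf k) hm, Measure.map_apply (hg k) hm]
    _ ≤ ϱ {x | r / 2 < ‖x‖} + μ {x | r / 2 < ‖x‖} := by
        refine add_le_add (measure_mono fun x hx => ?_) (measure_mono fun x hx => ?_)
        · have h3 := hf2 k x
          have h4 : r < ‖f k x‖ := hx
          show r / 2 < ‖x‖
          linarith
        · have h3 := hg2 k x
          have h4 : r < ‖g k x‖ := hx
          show r / 2 < ‖x‖
          linarith

/-- The support of a weak limit of measures that charge only cyclically monotone sets is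
cyclically monotone. -/
theorem isCyclicallyMonotone_support_of_tendsto {ι : Type*} {F : Filter ι} [F.NeBot]
    {P : ι → ProbabilityMeasure (Space n × Space n)} {Q : ProbabilityMeasure (Space n × Space n)}
    (hPQ : Tendsto P F (𝓝 Q)) (Γ : ι → Set (Space n × Space n))
    (hΓ : ∀ k, IsCyclicallyMonotone (Γ k))
    (hΓ' : ∀ k U, MeasurableSet U → 0 < (P k : Measure (Space n × Space n)) U →
      (U ∩ Γ k).Nonempty) :
    IsCyclicallyMonotone (Q : Measure (Space n × Space n)).support := by
  intro N p hp σ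
  by_contra! hlt
  -- Violating cyclic monotonicity is an open condition on the `N` pairs. By the portmanteau
  -- inequality, small neighbourhoods of the support points are eventually charged, so some `Γ k`
  -- would violate it too.
  have hW : {r : Fin N → Space n × Space n | ∑ i, (inner ℝ (r i).1 (r i).2 : ℝ) <
      ∑ i, (inner ℝ (r (σ i)).1 (r i).2 : ℝ)} ∈ 𝓝 p := by
    refine (isOpen_lt ?_ ?_).mem_nhds hlt
    · exact continuous_finsetSum _ fun i _ => by fun_prop
    · exact continuous_finsetSum _ fun i _ => by fun_prop
  rw [nhds_pi, Filter.mem_pi'] at hW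
  obtain ⟨I, t, ht, hsub⟩ := hW
  have hev : ∀ i, ∀ᶠ k in F, 0 < (P k : Measure (Space n × Space n)) (interior (t i)) := by
    intro i
    have h1 := (Measure.mem_support_iff_forall _).1 (hp i) _ (interior_mem_nhds.2 (ht i))
    exact eventually_lt_of_lt_liminf
      (h1.trans_le (ProbabilityMeasure.le_liminf_measure_open_of_tendsto hPQ isOpen_interior))
  obtain ⟨k, hk⟩ := (eventually_all.2 hev).exists
  choose r hr using fun i => hΓ' k _ isOpen_interior.measurableSet (hk i)
  have h2 := hΓ k N r (fun i => (hr i).2) σ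
  exact absurd (hsub (fun i _ => interior_subset (hr i).1) : r ∈ _) (not_lt.2 h2)

/-- **McCann's theorem**: two probability measures have a coupling concentrated on a cyclically
monotone set. -/
theorem exists_plan_isCyclicallyMonotone (ϱ μ : Measure (Space n)) [IsProbabilityMeasure ϱ]
    [IsProbabilityMeasure μ] : ∃ (π : Measure (Space n × Space n)) (Γ : Set (Space n × Space n)),
      π ∈ plans ϱ μ ∧ IsCyclicallyMonotone Γ ∧ Γ.Nonempty ∧ ∀ᵐ p ∂π, p ∈ Γ := by
  let q : ℕ → SimpleFunc (Space n) (Space n) := fun k =>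
    SimpleFunc.approxOn (id : Space n → Space n) measurable_id Set.univ 0 trivial k
  have hq : ∀ k, Measurable (q k) := fun k => (q k).measurable
  have hq2 : ∀ k x, ‖q k x‖ ≤ ‖x‖ + ‖x‖ := fun k x =>
    SimpleFunc.norm_approxOn_zero_le measurable_id _ x k
  choose π Γ h1 h2 hΓ hΓ' using fun k => exists_coupling_simpleFunc ϱ μ (q k) (q k)
  have hprob : ∀ k, IsProbabilityMeasure (π k) := by
    intro k
    have : IsProbabilityMeasure ((π k).map Prod.fst) := by
      rw [h1]; exact Measure.isProbabilityMeasure_map (hq k).aemeasurable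
    exact Measure.isProbabilityMeasure_of_map Prod.fst
  let P : ℕ → ProbabilityMeasure (Space n × Space n) := fun k => ⟨π k, hprob k⟩
  have htight := isTightMeasureSet_of_marginals ϱ μ (fun k => q k) (fun k => q k) hq hq hq2 hq2 π h1 h2
  have hcomp : IsCompact (closure (Set.range P)) := by
    refine isCompact_closure_of_isTightMeasureSet (htight.subset ?_)
    rintro _ ⟨_, ⟨k, rfl⟩, rfl⟩
    exact ⟨k, rfl⟩
  -- An ultrafilter finer than `atTop` takes the place of a convergent subsequence.
  let F : Ultrafilter ℕ := Ultrafilter.of atTop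
  have hF : (F : Filter ℕ) ≤ atTop := Ultrafilter.of_le _
  obtain ⟨Q, -, hQ⟩ := hcomp.ultrafilter_le_nhds (F.map P) (by
    rw [le_principal_iff]
    exact Filter.mem_of_superset (Filter.mem_map.2 (Filter.univ_mem' fun k => Set.mem_range_self k))
      subset_closure)
  have hPQ : Tendsto P F (𝓝 Q) := hQ
  refine ⟨Q, (Q : Measure (Space n × Space n)).support, ⟨?_, ?_⟩,
    isCyclicallyMonotone_support_of_tendsto hPQ Γ hΓ hΓ',
    Measure.nonempty_support (IsProbabilityMeasure.ne_zero _), Measure.support_mem_ae⟩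
  · have e := tendsto_nhds_unique
      (((ProbabilityMeasure.continuous_map continuous_fst).tendsto Q).comp hPQ)
      (((tendsto_map_approxOn ⟨ϱ, inferInstance⟩).mono_left hF).congr fun k =>
        Subtype.ext (h1 k).symm)
    exact congrArg Subtype.val e
  · have e := tendsto_nhds_unique
      (((ProbabilityMeasure.continuous_map continuous_snd).tendsto Q).comp hPQ)
      (((tendsto_map_approxOn ⟨μ, inferInstance⟩).mono_left hF).congr fun k =>
        Subtype.ext (h2 k).symm)
    exact congrArg Subtype.val e

/-! ### Extended-real integrals -/

section eintegral
variable {X : Type*} [MeasurableSpace X] {m : Measure X}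

theorem eintegral_coe_eq (f : X → ℝ) : eintegral m (fun x => (f x : EReal)) =
    ((∫⁻ x, ENNReal.ofReal (f x) ∂m : ENNReal) : EReal) -
      ((∫⁻ x, ENNReal.ofReal (-f x) ∂m : ENNReal) : EReal) := by
  simp only [eintegral, ← EReal.coe_neg, EReal.toENNReal_of_ne_top (EReal.coe_ne_top _),
    EReal.toReal_coe]

theorem eintegral_congr_ae {f g : X → EReal} (h : f =ᵐ[m] g) : eintegral m f = eintegral m g := by
  unfold eintegral
  rw [lintegral_congr_ae (f := fun x => (f x).toENNReal) (g := fun x => (g x).toENNReal) (h.fun_comp EReal.toENNReal),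
    lintegral_congr_ae (f := fun x => (-f x).toENNReal) (g := fun x => (-g x).toENNReal)
      (h.fun_comp fun a => (-a).toENNReal)]

theorem eintegral_coe_of_integrable {f : X → ℝ} (hf : Integrable f m) :
    eintegral m (fun x => (f x : EReal)) = ((∫ x, f x ∂m : ℝ) : EReal) := by
  have h1 : ∫⁻ x, ENNReal.ofReal (f x) ∂m ≠ ⊤ := hf.lintegral_lt_top.ne
  have h2 : ∫⁻ x, ENNReal.ofReal (-f x) ∂m ≠ ⊤ := hf.neg.lintegral_lt_top.ne
  rw [eintegral_coe_eq, integral_eq_lintegral_pos_part_sub_lintegral_neg_part hf, EReal.coe_sub,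
    ← EReal.coe_ennreal_toReal h1, ← EReal.coe_ennreal_toReal h2]

theorem eintegral_of_ae_eq_coe {f : X → EReal} {g : X → ℝ} (hg : Integrable g m)
    (h : ∀ᵐ x ∂m, f x = g x) : eintegral m f = ((∫ x, g x ∂m : ℝ) : EReal) := by
  rw [eintegral_congr_ae h, eintegral_coe_of_integrable hg]

/-- The majorant `h` keeps the positive part of `f` integrable, so a non-integrable `f` has an
infinite negative part and its integral is `⊥`. -/
theorem eintegral_coe_le {f h : X → ℝ} (hf : AEStronglyMeasurable f m) (hh : Integrable h m)
    (hle : ∀ᵐ x ∂m, f x ≤ h x) :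
    eintegral m (fun x => (f x : EReal)) ≤ ((∫ x, h x ∂m : ℝ) : EReal) := by
  by_cases hfi : Integrable f m
  · rw [eintegral_coe_of_integrable hfi, EReal.coe_le_coe_iff]
    exact integral_mono_ae hfi hh hle
  · have h1 : ∫⁻ x, ENNReal.ofReal (f x) ∂m < ⊤ :=
      (lintegral_mono_ae (hle.mono fun x hx => ENNReal.ofReal_le_ofReal hx)).trans_lt
        hh.lintegral_lt_top
    have h2 : ∫⁻ x, ENNReal.ofReal (-f x) ∂m = ⊤ := by
      by_contra h2
      refine hfi ⟨hf, ?_⟩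
      rw [hasFiniteIntegral_iff_norm]
      refine lt_of_le_of_lt ?_ (ENNReal.add_lt_top.2 ⟨h1, lt_top_iff_ne_top.2 h2⟩)
      rw [← lintegral_add_left' hf.aemeasurable.ennreal_ofReal]
      refine lintegral_mono fun x => ?_
      rw [Real.norm_eq_abs]
      rcases le_total 0 (f x) with h0 | h0
      · rw [abs_of_nonneg h0]; exact le_self_add
      · rw [abs_of_nonpos h0]; exact le_add_self
    rw [eintegral_coe_eq, h2]
    simp

/-- The minorant `h` controls the negative part, so an infinite positive part would give the value
`⊤`. -/
theorem integrable_of_eintegral_lt_top {f h : X → ℝ} (hf : AEStronglyMeasurable f m)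
    (hh : Integrable h m) (hle : ∀ᵐ x ∂m, h x ≤ f x)
    (hfin : eintegral m (fun x => (f x : EReal)) < ⊤) : Integrable f m := by
  have h2 : ∫⁻ x, ENNReal.ofReal (-f x) ∂m < ⊤ :=
    (lintegral_mono_ae (hle.mono fun x hx => ENNReal.ofReal_le_ofReal (neg_le_neg hx))).trans_lt
      hh.neg.lintegral_lt_top
  have h1 : ∫⁻ x, ENNReal.ofReal (f x) ∂m ≠ ⊤ := by
    intro h1
    rw [eintegral_coe_eq, h1, ← EReal.coe_ennreal_toReal h2.ne] at hfin
    simp at hfin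
  refine ⟨hf, ?_⟩
  rw [hasFiniteIntegral_iff_norm]
  refine lt_of_le_of_lt ?_ (ENNReal.add_lt_top.2 ⟨lt_top_iff_ne_top.2 h1, h2⟩)
  rw [← lintegral_add_left' hf.aemeasurable.ennreal_ofReal]
  refine lintegral_mono fun x => ?_
  rw [Real.norm_eq_abs]
  rcases le_total 0 (f x) with h0 | h0
  · rw [abs_of_nonneg h0]; exact le_self_add
  · rw [abs_of_nonpos h0]; exact le_add_self

end eintegral

/-! ### Legendre transform and Kantorovich duality -/

theorem lowerSemicontinuous_legendre (φ : Space n → EReal) :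
    LowerSemicontinuous (legendre φ) := by
  refine lowerSemicontinuous_iSup fun x => ?_
  induction φ x with
  | bot => simp only [EReal.coe_sub_bot]; exact lowerSemicontinuous_const
  | top => simp only [EReal.sub_top]; exact lowerSemicontinuous_const
  | coe a =>
    simp only [← EReal.coe_sub]
    exact (continuous_coe_real_ereal.comp (by fun_prop)).lowerSemicontinuous

theorem legendre_add_const (φ : Space n → EReal) (k : ℝ) (y : Space n) :
    legendre (fun x => φ x + k) y = legendre φ y - k := by
  have h : ∀ x, ((inner ℝ x y : ℝ) : EReal) - (φ x + k) = ((inner ℝ x y : ℝ) : EReal) - φ x - k := by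
    intro x
    induction φ x with
    | bot => simp
    | top => simp
    | coe a => norm_cast; ring
  simp only [legendre, h]
  apply le_antisymm
  · exact iSup_le fun x => EReal.sub_le_sub
      (le_iSup (fun x => ((inner ℝ x y : ℝ) : EReal) - φ x) x) le_rfl
  · refine EReal.sub_le_of_le_add (iSup_le fun x => ?_)
    refine EReal.sub_le_iff_le_add (by simp) (by simp) |>.1 ?_
    exact le_iSup (fun x => ((inner ℝ x y : ℝ) : EReal) - φ x - k) x

/-- At a subgradient the Fenchel–Young inequality is an equality. -/
theorem legendre_eq_of_subgradient {φ : Space n → EReal} {x y : Space n} {a : ℝ} (ha : φ x = a)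
    (h : ∀ z, ((a + inner ℝ (z - x) y : ℝ) : EReal) ≤ φ z) :
    legendre φ y = ((inner ℝ x y - a : ℝ) : EReal) := by
  apply le_antisymm
  · refine iSup_le fun z => (EReal.sub_le_sub le_rfl (h z)).trans_eq ?_
    rw [← EReal.coe_sub, inner_sub_left]
    congr 1
    ring
  · rw [EReal.coe_sub, ← ha]
    exact le_iSup (fun z => ((inner ℝ z y : ℝ) : EReal) - φ z) x

theorem integrable_comp_fst_of_mem_plans {ϱ μ : Measure (Space n)}
    {π : Measure (Space n × Space n)} (hπ : π ∈ plans ϱ μ) {f : Space n → ℝ} :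
    Integrable f ϱ → Integrable (fun p => f p.1) π := fun hf =>
  (hπ.1 ▸ hf : Integrable f (π.map Prod.fst)).comp_measurable measurable_fst

theorem integrable_comp_snd_of_mem_plans {ϱ μ : Measure (Space n)}
    {π : Measure (Space n × Space n)} (hπ : π ∈ plans ϱ μ) {f : Space n → ℝ} :
    Integrable f μ → Integrable (fun p => f p.2) π := fun hf =>
  (hπ.2 ▸ hf : Integrable f (π.map Prod.snd)).comp_measurable measurable_snd

theorem integral_add_of_mem_plans {ϱ μ : Measure (Space n)} {π : Measure (Space n × Space n)}
    (hπ : π ∈ plans ϱ μ) {f g : Space n → ℝ} (hf : Integrable f ϱ) (hg : Integrable g μ) :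
    ∫ p, (f p.1 + g p.2) ∂π = ∫ x, f x ∂ϱ + ∫ y, g y ∂μ := by
  rw [integral_add (integrable_comp_fst_of_mem_plans hπ hf) (integrable_comp_snd_of_mem_plans hπ hg)]
  congr 1
  · have h := hf.aestronglyMeasurable
    rw [← hπ.1] at h
    rw [← integral_map measurable_fst.aemeasurable h, hπ.1]
  · have h := hg.aestronglyMeasurable
    rw [← hπ.2] at h
    rw [← integral_map measurable_snd.aemeasurable h, hπ.2]

/-- Weak duality for the maximal correlation. -/
theorem maxCorr_le {ϱ μ : Measure (Space n)} {φ : Space n → EReal} {f g : Space n → ℝ}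
    (hf : Integrable f ϱ) (hg : Integrable g μ) (hfφ : ∀ᵐ x ∂ϱ, φ x = f x)
    (hgφ : ∀ᵐ y ∂μ, legendre φ y = g y) :
    maxCorr ϱ μ ≤ ((∫ x, f x ∂ϱ + ∫ y, g y ∂μ : ℝ) : EReal) := by
  refine iSup₂_le fun π hπ => ?_
  rw [← integral_add_of_mem_plans hπ hf hg]
  refine eintegral_coe_le ?_
    ((integrable_comp_fst_of_mem_plans hπ hf).add (integrable_comp_snd_of_mem_plans hπ hg)) ?_
  · exact Continuous.aestronglyMeasurable (by fun_prop)
  · have h1 : ∀ᵐ p ∂π, φ p.1 = f p.1 :=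
      ae_of_ae_map measurable_fst.aemeasurable (by rw [hπ.1]; exact hfφ)
    have h2 : ∀ᵐ p ∂π, legendre φ p.2 = g p.2 :=
      ae_of_ae_map measurable_snd.aemeasurable (by rw [hπ.2]; exact hgφ)
    filter_upwards [h1, h2] with p hp1 hp2
    have h := le_iSup (fun x => ((inner ℝ x p.2 : ℝ) : EReal) - φ x) p.1
    change _ ≤ legendre φ p.2 at h
    simp only [hp1] at h
    rw [hp2, ← EReal.coe_sub, EReal.coe_le_coe_iff] at h
    linarith

theorem integrable_inner_add {ϱ : Measure (Space n)} (hϱ : ϱ ∈ FiniteFirstMoment n)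
    (v : Space n) (r : ℝ) : Integrable (fun x => (inner ℝ x v : ℝ) + r) ϱ := by
  have := hϱ.1
  have hid : Integrable (fun x : Space n => x) ϱ := ⟨aestronglyMeasurable_id, hϱ.2⟩
  exact (hid.inner_const v).add (integrable_const r)

/-- Strong duality for the maximal correlation, with a potential that is a supremum of affine
functions. -/
theorem exists_potential {ϱ μ : Measure (Space n)} (hϱ : ϱ ∈ FiniteFirstMoment n)
    (hμ : μ ∈ FiniteFirstMoment n) (hT : maxCorr ϱ μ < ⊤) :
    ∃ (S : Set (Space n × ℝ)) (f g : Space n → ℝ), IsConv (supAffine S) ∧ S.Nonempty ∧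
      Integrable f ϱ ∧ Integrable g μ ∧ (∀ᵐ x ∂ϱ, supAffine S x = f x) ∧
      (∀ᵐ y ∂μ, legendre (supAffine S) y = g y) ∧
      maxCorr ϱ μ = ((∫ x, f x ∂ϱ + ∫ y, g y ∂μ : ℝ) : EReal) := by
  have := hϱ.1
  have := hμ.1
  obtain ⟨π, Γ, hπ, hΓ, ⟨p₁, hp₁⟩, hae⟩ := exists_plan_isCyclicallyMonotone ϱ μ
  obtain ⟨S, hS, hSΓ⟩ := exists_supAffine_of_isCyclicallyMonotone hΓ ⟨p₁, hp₁⟩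
  set φ := supAffine S with hφ
  obtain ⟨a₁, ha₁, -⟩ := hSΓ p₁ hp₁
  obtain ⟨s, hs⟩ := hS
  have hconv : IsConv φ := isConv_supAffine ⟨s, hs⟩ ⟨p₁.1, by rw [← hφ, ha₁]; simp⟩
  let f : Space n → ℝ := fun x => (φ x).toReal
  let g : Space n → ℝ := fun y => (legendre φ y).toReal
  have hφm : Measurable φ := (lowerSemicontinuous_supAffine S).measurable
  have hψm : Measurable (legendre φ) := (lowerSemicontinuous_legendre φ).measurable
  have hfm : Measurable f := hφm.ereal_toReal
  have hgm : Measurable g := hψm.ereal_toReal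
  have hπf : ∀ᵐ p ∂π, φ p.1 = f p.1 := by
    filter_upwards [hae] with p hp
    obtain ⟨a, ha, -⟩ := hSΓ p hp
    simp [f, ha]
  have hπg : ∀ᵐ p ∂π, legendre φ p.2 = g p.2 := by
    filter_upwards [hae] with p hp
    obtain ⟨a, ha, hz⟩ := hSΓ p hp
    simp only [g, legendre_eq_of_subgradient ha hz, EReal.toReal_coe]
  have hsum : ∀ᵐ p ∂π, (inner ℝ p.1 p.2 : ℝ) = f p.1 + g p.2 := by
    filter_upwards [hae] with p hp
    obtain ⟨a, ha, hz⟩ := hSΓ p hp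
    simp only [f, g, legendre_eq_of_subgradient ha hz, ha, EReal.toReal_coe]
    ring
  have hϱf : ∀ᵐ x ∂ϱ, φ x = f x := by
    rw [← hπ.1]
    exact (ae_map_iff measurable_fst.aemeasurable
      (measurableSet_eq_fun hφm hfm.coe_real_ereal)).2 hπf
  have hμg : ∀ᵐ y ∂μ, legendre φ y = g y := by
    rw [← hπ.2]
    exact (ae_map_iff measurable_snd.aemeasurable
      (measurableSet_eq_fun hψm hgm.coe_real_ereal)).2 hπg
  -- Affine minorants of `f` and `g`, the first from a member of `S`, the second from the
  -- Fenchel–Young inequality at `p₁`; the finite first moments make them integrable.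
  have hlf : ∀ᵐ p ∂π, (inner ℝ p.1 s.1 : ℝ) + s.2 ≤ f p.1 := by
    filter_upwards [hπf] with p hp
    rw [← EReal.coe_le_coe_iff, ← hp]
    exact le_supAffine hs p.1
  have hlg : ∀ᵐ p ∂π, (inner ℝ p.2 p₁.1 : ℝ) + (-a₁) ≤ g p.2 := by
    filter_upwards [hπg] with p hp
    rw [← EReal.coe_le_coe_iff, ← hp, ← sub_eq_add_neg, EReal.coe_sub, ← ha₁, real_inner_comm]
    exact le_iSup (fun x => ((inner ℝ x p.2 : ℝ) : EReal) - φ x) p₁.1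
  have hif := integrable_comp_fst_of_mem_plans hπ (integrable_inner_add hϱ s.1 s.2)
  have hig := integrable_comp_snd_of_mem_plans hπ (integrable_inner_add hμ p₁.1 (-a₁))
  have hcm : AEStronglyMeasurable (fun p : Space n × Space n => (inner ℝ p.1 p.2 : ℝ)) π :=
    Continuous.aestronglyMeasurable (by fun_prop)
  have hπT : eintegral π (fun p => ((inner ℝ p.1 p.2 : ℝ) : EReal)) ≤ maxCorr ϱ μ :=
    le_iSup₂ (f := fun (π : Measure (Space n × Space n)) (_ : π ∈ plans ϱ μ) =>
      eintegral π (fun p => ((inner ℝ p.1 p.2 : ℝ) : EReal))) π hπ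
  have hc : Integrable (fun p : Space n × Space n => (inner ℝ p.1 p.2 : ℝ)) π := by
    refine integrable_of_eintegral_lt_top hcm (hif.add hig) ?_ (hπT.trans_lt hT)
    filter_upwards [hsum, hlf, hlg] with p h1 h2 h3
    simp only [Pi.add_apply]
    linarith
  -- Since `f + g` is the integrable correlation, the minorant of `g` yields an integrable majorant
  -- of `f`.
  have hf' : Integrable (fun p : Space n × Space n => f p.1) π := by
    refine integrable_of_le_of_le (hfm.comp measurable_fst).aestronglyMeasurable hlf ?_ hif
      (hc.sub hig)
    filter_upwards [hsum, hlg] with p h1 h3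
    simp only [Pi.sub_apply]
    linarith
  have hg' : Integrable (fun p : Space n × Space n => g p.2) π := by
    refine (hc.sub hf').congr ?_
    filter_upwards [hsum] with p h1
    simp only [Pi.sub_apply]
    linarith
  have hf : Integrable f ϱ := by
    rw [← hπ.1, integrable_map_measure hfm.aestronglyMeasurable measurable_fst.aemeasurable]
    exact hf'
  have hg : Integrable g μ := by
    rw [← hπ.2, integrable_map_measure hgm.aestronglyMeasurable measurable_snd.aemeasurable]
    exact hg'
  refine ⟨S, f, g, hconv, ⟨s, hs⟩, hf, hg, hϱf, hμg, le_antisymm (maxCorr_le hf hg hϱf hμg) ?_⟩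
  rw [← integral_add_of_mem_plans hπ hf hg, ← integral_congr_ae hsum,
    ← eintegral_coe_of_integrable hc]
  exact hπT

/-- Strong duality, with a potential whose integral is prescribed. -/
theorem exists_potential_of_integral {ϱ μ : Measure (Space n)} (hϱ : ϱ ∈ FiniteFirstMoment n)
    (hμ : μ ∈ FiniteFirstMoment n) (hT : maxCorr ϱ μ < ⊤) (A : ℝ) :
    ∃ (φ : Space n → EReal) (f g : Space n → ℝ), IsConv φ ∧
      Integrable f ϱ ∧ Integrable g μ ∧ (∀ᵐ x ∂ϱ, φ x = f x) ∧
      (∀ᵐ y ∂μ, legendre φ y = g y) ∧ ∫ x, f x ∂ϱ = A ∧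
      maxCorr ϱ μ = ((∫ x, f x ∂ϱ + ∫ y, g y ∂μ : ℝ) : EReal) := by
  have := hϱ.1
  have := hμ.1
  obtain ⟨S, f, g, hconv, hS, hf, hg, hϱf, hμg, heq⟩ := exists_potential hϱ hμ hT
  let k : ℝ := A - ∫ x, f x ∂ϱ
  have he : supAffine ((fun s : Space n × ℝ => (s.1, s.2 + k)) '' S) =
      fun x => supAffine S x + k := funext (supAffine_image_add S k)
  refine ⟨fun x => supAffine S x + k, fun x => f x + k, fun y => g y - k, ?_,
    hf.add (integrable_const k), hg.sub (integrable_const k), ?_, ?_, ?_, ?_⟩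
  · rw [← he]
    refine isConv_supAffine (hS.image _) ?_
    obtain ⟨x, hx⟩ := hconv.proper
    exact ⟨x, by rw [he]; exact EReal.add_lt_top hx.ne (EReal.coe_ne_top k)⟩
  · filter_upwards [hϱf] with x hx
    rw [hx, EReal.coe_add]
  · filter_upwards [hμg] with y hy
    rw [legendre_add_const, hy, ← EReal.coe_sub]
  · rw [integral_add hf (integrable_const k)]
    simp [k]
  · rw [heq, integral_add hf (integrable_const k), integral_sub hg (integrable_const k)]
    simp

/-! ### Finiteness of the energy and of the maximal correlation -/

theorem ennreal_rpow_le_rpow_of_nonpos {x y : ENNReal} (h : x ≤ y) {z : ℝ} (hz : z ≤ 0) :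
    y ^ z ≤ x ^ z := by
  rw [← neg_neg z, ENNReal.rpow_neg, ENNReal.rpow_neg x, ENNReal.inv_le_inv]
  exact ENNReal.rpow_le_rpow h (by linarith)

/-- Either `ρ ≥ W ^ (1/α - 1)`, and then `ρ ^ (1/(1-α) - 1) ≤ W` because the exponents are negative
and inverse to each other, or `ρ ^ (1/(1-α)) ≤ W ^ (1/α)`. -/
theorem rpow_le_mul_add_rpow {α : ℝ} (hα0 : α < 0) {ρ W : ENNReal} (hρ : ρ ≠ ⊤) (hW0 : W ≠ 0)
    (hW : W ≠ ⊤) : ρ ^ (1 / (1 - α)) ≤ ρ * W + W ^ (1 / α) := by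
  have h1 : 0 < 1 - α := by linarith
  have hp : 1 / α - 1 < 0 := by
    have := one_div_neg.2 hα0
    linarith
  rcases le_total (W ^ (1 / α - 1)) ρ with h | h
  · refine le_add_right ?_
    have hρ0 : ρ ≠ 0 := fun h0 => by
      rw [h0, le_zero_iff, ENNReal.rpow_eq_zero_iff] at h
      rcases h with h | h
      exacts [hW0 h.1, hW h.1]
    have e : 1 / (1 - α) = 1 + (1 / α - 1)⁻¹ := by
      have : 1 / α - 1 ≠ 0 := hp.ne
      have : 1 - α ≠ 0 := h1.ne'
      have := hα0.ne
      field_simp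
      ring
    rw [e, ENNReal.rpow_add _ _ hρ0 hρ, ENNReal.rpow_one]
    gcongr
    exact (ennreal_rpow_le_rpow_of_nonpos h (inv_nonpos.2 hp.le)).trans_eq
      (ENNReal.rpow_rpow_inv hp.ne W)
  · refine le_add_left ((ENNReal.rpow_le_rpow h (by positivity)).trans_eq ?_)
    rw [← ENNReal.rpow_mul]
    congr 1
    have : 1 - α ≠ 0 := h1.ne'
    have := hα0.ne
    field_simp

/-- Taking the weight `W = 1 + ‖x‖` leaves a first moment and the integral of `(1 + ‖x‖) ^ (1/α)`,
which converges because `-1/α > n`. -/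
theorem lintegral_rnDeriv_rpow_lt_top (hn : 1 ≤ n) {α : ℝ} (hα : -(1 / (n : ℝ)) < α) (hα0 : α < 0)
    {ϱ : Measure (Space n)} (hϱ : ϱ ∈ FiniteFirstMoment n) :
    ∫⁻ x, (ϱ.rnDeriv volume x) ^ (1 / (1 - α)) < ⊤ := by
  have := hϱ.1
  have hn' : (0 : ℝ) < n := by exact_mod_cast hn
  have hr : (Module.finrank ℝ (Space n) : ℝ) < -(1 / α) := by
    rw [finrank_euclideanSpace_fin, ← one_div_neg_eq_neg_one_div, lt_one_div hn' (by linarith)]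
    linarith
  have hfin := finite_integral_one_add_norm (μ := (volume : Measure (Space n))) hr
  have hmom : ∫⁻ x, ϱ.rnDeriv volume x * (1 + ‖x‖ₑ) < ⊤ := by
    have hm : Measurable fun x : Space n => 1 + ‖x‖ₑ := by fun_prop
    have h1 := lintegral_withDensity_eq_lintegral_mul (volume : Measure (Space n))
      (Measure.measurable_rnDeriv ϱ volume) hm
    simp only [Pi.mul_apply] at h1
    rw [← h1]
    refine (lintegral_mono' (Measure.withDensity_rnDeriv_le ϱ volume) le_rfl).trans_lt ?_
    rw [lintegral_add_left measurable_const]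
    simpa using hϱ.2
  refine lt_of_le_of_lt (lintegral_mono_ae ?_) (lt_of_eq_of_lt (lintegral_add_left ?_ _)
    (ENNReal.add_lt_top.2 ⟨hmom, hfin⟩))
  · filter_upwards [Measure.rnDeriv_lt_top ϱ volume] with x hx
    have hW : ENNReal.ofReal (1 + ‖x‖) = 1 + ‖x‖ₑ := by
      rw [ENNReal.ofReal_add zero_le_one (norm_nonneg x), ENNReal.ofReal_one, ofReal_norm]
    have h := rpow_le_mul_add_rpow hα0 hx.ne (W := 1 + ‖x‖ₑ) (by simp) (by simp)
    rwa [← hW, ENNReal.ofReal_rpow_of_pos (by positivity), ← neg_neg (1 / α), hW] at h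
  · exact (Measure.measurable_rnDeriv ϱ volume).mul (by fun_prop)

theorem objective_eq (α : ℝ) (μ ϱ : Measure (Space n)) : objective α μ ϱ =
    ((1 - α : ℝ) : EReal) * energy α ϱ + ((-α : ℝ) : EReal) * maxCorr ϱ μ := by
  rw [objective, sub_eq_add_neg, ← EReal.neg_mul, EReal.coe_neg]

theorem dirac_mem_finiteFirstMoment (x : Space n) : Measure.dirac x ∈ FiniteFirstMoment n :=
  ⟨inferInstance, by simp [lintegral_dirac]⟩

theorem maxCorr_dirac_zero_le (μ : Measure (Space n)) : maxCorr (Measure.dirac 0) μ ≤ 0 := by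
  refine iSup₂_le fun π hπ => ?_
  have h : ∀ᵐ p ∂π, p.1 = 0 := by
    refine ae_of_ae_map (p := fun x : Space n => x = 0) measurable_fst.aemeasurable ?_
    rw [hπ.1, ae_dirac_eq]
    rfl
  rw [eintegral_of_ae_eq_coe (g := fun _ => (0 : ℝ)) (integrable_zero _ _ _)]
  · simp
  · filter_upwards [h] with p hp
    simp [hp]

theorem energy_eq_coe (hn : 1 ≤ n) {α : ℝ} (hα : -(1 / (n : ℝ)) < α) (hα0 : α < 0)
    {ϱ : Measure (Space n)} (hϱ : ϱ ∈ FiniteFirstMoment n) :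
    energy α ϱ =
      ((-(∫⁻ x, (ϱ.rnDeriv volume x) ^ (1 / (1 - α))).toReal : ℝ) : EReal) := by
  rw [energy, EReal.coe_neg, EReal.coe_ennreal_toReal (lintegral_rnDeriv_rpow_lt_top hn hα hα0 hϱ).ne]

/-- The maximal correlation of a minimiser is finite. -/
theorem maxCorr_lt_top_of_minimizer (hn : 1 ≤ n) {α : ℝ} (hα : -(1 / (n : ℝ)) < α) (hα0 : α < 0)
    {μ ϱ₀ : Measure (Space n)} (hϱ₀ : ϱ₀ ∈ FiniteFirstMoment n)
    (hmin : ∀ ϱ ∈ FiniteFirstMoment n, objective α μ ϱ₀ ≤ objective α μ ϱ) :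
    maxCorr ϱ₀ μ < ⊤ := by
  -- The Dirac mass at `0` has finite energy and correlation at most `0`, so the minimal value is
  -- below `⊤`.
  have h := hmin _ (dirac_mem_finiteFirstMoment 0)
  by_contra hT
  rw [not_lt_top_iff] at hT
  rw [objective_eq, objective_eq, hT, energy_eq_coe hn hα hα0 hϱ₀,
    energy_eq_coe hn hα hα0 (dirac_mem_finiteFirstMoment 0),
    EReal.coe_mul_top_of_pos (by linarith), ← EReal.coe_mul, EReal.coe_add_top, top_le_iff] at h
  have h2 : ((-α : ℝ) : EReal) * maxCorr (Measure.dirac 0) μ ≤ 0 := by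
    refine (mul_le_mul_of_nonneg_left (maxCorr_dirac_zero_le μ)
      (EReal.coe_nonneg.2 (by linarith))).trans_eq (mul_zero _)
  refine absurd h (ne_of_lt ?_)
  rw [← EReal.coe_mul]
  exact EReal.add_lt_top (EReal.coe_ne_top _) (h2.trans_lt EReal.zero_lt_top).ne

/-! ### Concave powers along mixtures -/

/-- The tangent inequality for a concave power along a segment. -/
theorem rpow_segment_le {m : ℝ} (hm0 : 0 < m) (hm1 : m < 1) {ε : ℝ} (hε0 : 0 < ε) (hε1 : ε < 1)
    {ρ f : ℝ} (hρ : 0 ≤ ρ) (hf : 0 ≤ f) (hr : 0 < (1 - ε) * ρ + ε * f) :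
    ρ ^ m + m * ε * (f * ((1 - ε) * ρ + ε * f) ^ (m - 1)) ≤
      ((1 - ε) * ρ + ε * f) ^ m + m * ε * ((1 - ε) ^ (m - 1) * ρ ^ m) := by
  set r := (1 - ε) * ρ + ε * f with hrdef
  -- Bernoulli's inequality for `ρ / r`, that is, the tangent of `t ^ m` at `r`.
  have h1 : ρ ^ m ≤ r ^ m + m * r ^ (m - 1) * (ρ - r) := by
    have hb := rpow_one_add_le_one_add_mul_self (s := ρ / r - 1) (p := m)
      (by have : 0 ≤ ρ / r := by positivity
          linarith) hm0.le hm1.le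
    rw [add_sub_cancel, Real.div_rpow hρ hr.le, div_le_iff₀ (by positivity)] at hb
    refine hb.trans_eq ?_
    have e : r ^ m = r ^ (m - 1) * r := by
      rw [← Real.rpow_add_one hr.ne', sub_add_cancel]
    rw [e]
    field_simp
  -- As `m - 1 < 0`, the bound `r ≥ (1 - ε) ρ` removes `f` and leaves a multiple of `ρ ^ m`, whose
  -- integral is finite.
  have h2 : ρ * r ^ (m - 1) ≤ (1 - ε) ^ (m - 1) * ρ ^ m := by
    rcases hρ.eq_or_lt with rfl | hρ'
    · simp [Real.zero_rpow hm0.ne']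
    · have h3 : (1 - ε) * ρ ≤ r := by rw [hrdef]; nlinarith
      have h4 := Real.rpow_le_rpow_of_nonpos (z := m - 1) (by nlinarith) h3 (by linarith)
      rw [Real.mul_rpow (by linarith) hρ] at h4
      have e : ρ ^ m = ρ ^ (m - 1) * ρ := by
        rw [← Real.rpow_add_one hρ'.ne', sub_add_cancel]
      rw [e]
      nlinarith
  have h5 : ρ - r = ε * (ρ - f) := by rw [hrdef]; ring
  rw [h5] at h1
  nlinarith [mul_pos hm0 hε0]

/-- All terms are placed so that no subtraction occurs. If `ρ = f = 0`, the infinite factor `0 ^ (m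
- 1)` is multiplied by `f = 0`. -/
theorem ennreal_rpow_segment_le {m : ℝ} (hm0 : 0 < m) (hm1 : m < 1) {ε : ℝ} (hε0 : 0 < ε)
    (hε1 : ε < 1) {ρ f : ENNReal} (hρ : ρ ≠ ⊤) (hf : f ≠ ⊤) :
    ρ ^ m + ENNReal.ofReal (m * ε) *
        (f * (ENNReal.ofReal (1 - ε) * ρ + ENNReal.ofReal ε * f) ^ (m - 1)) ≤
      (ENNReal.ofReal (1 - ε) * ρ + ENNReal.ofReal ε * f) ^ m +
        ENNReal.ofReal (m * ε * (1 - ε) ^ (m - 1)) * ρ ^ m := by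
  have hε' : 0 < 1 - ε := by linarith
  obtain ⟨a, ha, rfl⟩ : ∃ a : ℝ, 0 ≤ a ∧ ρ = ENNReal.ofReal a :=
    ⟨ρ.toReal, ENNReal.toReal_nonneg, (ENNReal.ofReal_toReal hρ).symm⟩
  obtain ⟨b, hb, rfl⟩ : ∃ b : ℝ, 0 ≤ b ∧ f = ENNReal.ofReal b :=
    ⟨f.toReal, ENNReal.toReal_nonneg, (ENNReal.ofReal_toReal hf).symm⟩
  rw [← ENNReal.ofReal_mul hε'.le, ← ENNReal.ofReal_mul hε0.le,
    ← ENNReal.ofReal_add (by positivity) (by positivity)]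
  have hr0 : 0 ≤ (1 - ε) * a + ε * b := by positivity
  rcases hr0.eq_or_lt with h | h
  · have ha0 : a = 0 := by nlinarith [mul_nonneg hε0.le hb, mul_nonneg hε'.le ha]
    have hb0 : b = 0 := by nlinarith [mul_nonneg hε0.le hb, mul_nonneg hε'.le ha]
    simp [ha0, hb0, hm0]
  · rw [ENNReal.ofReal_rpow_of_nonneg ha hm0.le, ENNReal.ofReal_rpow_of_pos h,
      ENNReal.ofReal_rpow_of_pos h, ← ENNReal.ofReal_mul hb, ← ENNReal.ofReal_mul (by positivity),
      ← ENNReal.ofReal_mul (by positivity), ← ENNReal.ofReal_add (by positivity) (by positivity),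
      ← ENNReal.ofReal_add (by positivity) (by positivity), mul_assoc (m * ε) _ (a ^ m)]
    exact ENNReal.ofReal_le_ofReal (rpow_segment_le hm0 hm1 hε0 hε1 ha hb h)

/-- The mixture `(1 - ε) ϱ + ε η`. -/
def mix (ε : ℝ) (ϱ η : Measure (Space n)) : Measure (Space n) :=
  ENNReal.ofReal (1 - ε) • ϱ + ENNReal.ofReal ε • η

theorem mix_mem_finiteFirstMoment {ε : ℝ} (h0 : 0 < ε) (h1 : ε < 1) {ϱ η : Measure (Space n)}
    (hϱ : ϱ ∈ FiniteFirstMoment n) (hη : η ∈ FiniteFirstMoment n) :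
    mix ε ϱ η ∈ FiniteFirstMoment n := by
  have := hϱ.1
  have := hη.1
  refine ⟨⟨?_⟩, ?_⟩
  · simp only [mix, Measure.add_apply, Measure.smul_apply, measure_univ, smul_eq_mul, mul_one]
    rw [← ENNReal.ofReal_add (by linarith) h0.le]
    simp
  · simp only [mix, lintegral_add_measure, lintegral_smul_measure, smul_eq_mul]
    exact ENNReal.add_lt_top.2 ⟨ENNReal.mul_lt_top ENNReal.ofReal_lt_top hϱ.2,
      ENNReal.mul_lt_top ENNReal.ofReal_lt_top hη.2⟩

theorem rnDeriv_mix (ε : ℝ) (ϱ η : Measure (Space n)) [IsProbabilityMeasure ϱ]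
    [IsProbabilityMeasure η] : ∀ᵐ x, (mix ε ϱ η).rnDeriv volume x =
      ENNReal.ofReal (1 - ε) * ϱ.rnDeriv volume x + ENNReal.ofReal ε * η.rnDeriv volume x := by
  have := Measure.smul_finite ϱ (ENNReal.ofReal_ne_top (r := 1 - ε))
  have := Measure.smul_finite η (ENNReal.ofReal_ne_top (r := ε))
  filter_upwards [Measure.rnDeriv_add (ENNReal.ofReal (1 - ε) • ϱ) (ENNReal.ofReal ε • η) volume,
    Measure.rnDeriv_smul_left_of_ne_top ϱ volume (ENNReal.ofReal_ne_top (r := 1 - ε)),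
    Measure.rnDeriv_smul_left_of_ne_top η volume (ENNReal.ofReal_ne_top (r := ε))] with x h1 h2 h3
  rw [mix, h1, Pi.add_apply, h2, h3]
  simp

theorem integrable_mix (ε : ℝ) {ϱ η : Measure (Space n)} {f : Space n → ℝ} (hϱ : Integrable f ϱ)
    (hη : Integrable f η) : Integrable f (mix ε ϱ η) :=
  (hϱ.smul_measure ENNReal.ofReal_ne_top).add_measure (hη.smul_measure ENNReal.ofReal_ne_top)

theorem integral_mix {ε : ℝ} (h0 : 0 < ε) (h1 : ε < 1) {ϱ η : Measure (Space n)} {f : Space n → ℝ}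
    (hϱ : Integrable f ϱ) (hη : Integrable f η) :
    ∫ x, f x ∂(mix ε ϱ η) = (1 - ε) * ∫ x, f x ∂ϱ + ε * ∫ x, f x ∂η := by
  rw [mix, integral_add_measure (hϱ.smul_measure ENNReal.ofReal_ne_top)
    (hη.smul_measure ENNReal.ofReal_ne_top), integral_smul_measure, integral_smul_measure,
    ENNReal.toReal_ofReal (by linarith), ENNReal.toReal_ofReal h0.le]
  simp

/-! ### Linearisation and first variation -/

section minimizer

variable (hn : 1 ≤ n) {α : ℝ} (hα : -(1 / (n : ℝ)) < α) (hα0 : α < 0)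
  {μ ϱ₀ : Measure (Space n)} (hϱ₀ : ϱ₀ ∈ FiniteFirstMoment n)
  (hmin : ∀ ϱ ∈ FiniteFirstMoment n, objective α μ ϱ₀ ≤ objective α μ ϱ)
  {φ : Space n → EReal} {f g : Space n → ℝ} (hg : Integrable g μ)
  (hgφ : ∀ᵐ y ∂μ, legendre φ y = g y)
  (hT : maxCorr ϱ₀ μ = ((∫ x, f x ∂ϱ₀ + ∫ y, g y ∂μ : ℝ) : EReal))
include hn hα hα0 hϱ₀ hmin hg hgφ hT

/-- A minimiser also minimises the functional linearised with an optimal potential. -/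
theorem linearized_objective_le {ϱ : Measure (Space n)} (hϱ : ϱ ∈ FiniteFirstMoment n)
    (hfϱ : Integrable f ϱ) (hfφϱ : ∀ᵐ x ∂ϱ, φ x = f x) :
    (1 - α) * ((∫⁻ x, (ϱ.rnDeriv volume x) ^ (1 / (1 - α))).toReal -
      (∫⁻ x, (ϱ₀.rnDeriv volume x) ^ (1 / (1 - α))).toReal) ≤
      -α * (∫ x, f x ∂ϱ - ∫ x, f x ∂ϱ₀) := by
  have h := hmin ϱ hϱ
  rw [objective_eq, objective_eq, hT, energy_eq_coe hn hα hα0 hϱ₀, energy_eq_coe hn hα hα0 hϱ] at h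
  -- Weak duality at `ϱ` against equality at `ϱ₀`: the integral of `g` cancels.
  have h2 := mul_le_mul_of_nonneg_left (maxCorr_le hfϱ hg hfφϱ hgφ)
    (EReal.coe_nonneg.2 (by linarith : (0 : ℝ) ≤ -α))
  have h3 := h.trans (add_le_add le_rfl h2)
  norm_cast at h3
  nlinarith

variable (hf : Integrable f ϱ₀) (hfφ : ∀ᵐ x ∂ϱ₀, φ x = f x)
include hf hfφ

/-- The first variation in a direction `η`, before the passage to the limit. -/
theorem lintegral_mix_le {η : Measure (Space n)} (hη : η ∈ FiniteFirstMoment n)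
    (hfη : Integrable f η) (hfφη : ∀ᵐ x ∂η, φ x = f x) {ε : ℝ} (hε0 : 0 < ε) (hε1 : ε < 1) :
    (0 ≤ (1 - ε) ^ (1 / (1 - α) - 1) * (∫⁻ x, (ϱ₀.rnDeriv volume x) ^ (1 / (1 - α))).toReal
      - α * (∫ x, f x ∂η - ∫ x, f x ∂ϱ₀)) ∧
    ∫⁻ x, η.rnDeriv volume x * (ENNReal.ofReal (1 - ε) * ϱ₀.rnDeriv volume x +
      ENNReal.ofReal ε * η.rnDeriv volume x) ^ (1 / (1 - α) - 1) ≤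
      ENNReal.ofReal ((1 - ε) ^ (1 / (1 - α) - 1) *
        (∫⁻ x, (ϱ₀.rnDeriv volume x) ^ (1 / (1 - α))).toReal
      - α * (∫ x, f x ∂η - ∫ x, f x ∂ϱ₀)) := by
  have := hϱ₀.1
  have := hη.1
  have hα1 : 0 < 1 - α := by linarith
  set m := 1 / (1 - α) with hm
  have hm0 : 0 < m := by positivity
  have hm1 : m < 1 := by rw [hm, div_lt_one hα1]; linarith
  have hmα : m * (1 - α) = 1 := by rw [hm]; field_simp
  have hϱ := mix_mem_finiteFirstMoment hε0 hε1 hϱ₀ hη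
  have hlin := linearized_objective_le hn hα hα0 hϱ₀ hmin hg hgφ hT hϱ
    (integrable_mix ε hf hfη) (ae_add_measure_iff.2
      ⟨Measure.ae_smul_measure hfφ _, Measure.ae_smul_measure hfφη _⟩)
  rw [integral_mix hε0 hε1 hf hfη, ← hm] at hlin
  have hE0 := lintegral_rnDeriv_rpow_lt_top hn hα hα0 hϱ₀
  have hE := lintegral_rnDeriv_rpow_lt_top hn hα hα0 hϱ
  rw [← hm] at hE0 hE
  set E0 := ∫⁻ x, (ϱ₀.rnDeriv volume x) ^ m
  set E := ∫⁻ x, ((mix ε ϱ₀ η).rnDeriv volume x) ^ m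
  set X := ∫⁻ x, η.rnDeriv volume x * (ENNReal.ofReal (1 - ε) * ϱ₀.rnDeriv volume x +
      ENNReal.ofReal ε * η.rnDeriv volume x) ^ (m - 1) with hX
  have hmρ := Measure.measurable_rnDeriv ϱ₀ (volume : Measure (Space n))
  have hmη := Measure.measurable_rnDeriv η (volume : Measure (Space n))
  have hmε := Measure.measurable_rnDeriv (mix ε ϱ₀ η) (volume : Measure (Space n))
  have key : E0 + ENNReal.ofReal (m * ε) * X ≤
      E + ENNReal.ofReal (m * ε * (1 - ε) ^ (m - 1)) * E0 := by
    rw [hX, ← lintegral_const_mul' _ _ ENNReal.ofReal_ne_top,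
      ← lintegral_const_mul' _ _ ENNReal.ofReal_ne_top, ← lintegral_add_left (by fun_prop),
      ← lintegral_add_left (by fun_prop)]
    refine lintegral_mono_ae ?_
    filter_upwards [Measure.rnDeriv_lt_top ϱ₀ volume, Measure.rnDeriv_lt_top η volume,
      rnDeriv_mix ε ϱ₀ η] with x h1 h2 h3
    rw [h3]
    exact ennreal_rpow_segment_le hm0 hm1 hε0 hε1 h1.ne h2.ne
  have hmε0 : 0 < m * ε := by positivity
  have hRfin : E + ENNReal.ofReal (m * ε * (1 - ε) ^ (m - 1)) * E0 ≠ ⊤ :=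
    ENNReal.add_ne_top.2 ⟨hE.ne, ENNReal.mul_ne_top ENNReal.ofReal_ne_top hE0.ne⟩
  have hXfin : X ≠ ⊤ := by
    intro h
    rw [h, ENNReal.mul_top (by simpa using hmε0)] at key
    simp only [add_top, top_le_iff] at key
    exact hRfin key
  have hε' : 0 < 1 - ε := by linarith
  have keyR := ENNReal.toReal_mono hRfin key
  rw [ENNReal.toReal_add hE0.ne (ENNReal.mul_ne_top ENNReal.ofReal_ne_top hXfin),
    ENNReal.toReal_add hE.ne (ENNReal.mul_ne_top ENNReal.ofReal_ne_top hE0.ne), ENNReal.toReal_mul,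
    ENNReal.toReal_mul, ENNReal.toReal_ofReal hmε0.le, ENNReal.toReal_ofReal (by positivity)] at keyR
  have hmain : X.toReal ≤ (1 - ε) ^ (m - 1) * E0.toReal - α * (∫ x, f x ∂η - ∫ x, f x ∂ϱ₀) := by
    have h1 : m * ((1 - α) * (E.toReal - E0.toReal)) ≤
        m * (-α * ((1 - ε) * ∫ x, f x ∂ϱ₀ + ε * ∫ x, f x ∂η - ∫ x, f x ∂ϱ₀)) :=
      mul_le_mul_of_nonneg_left hlin hm0.le
    rw [← mul_assoc, hmα, one_mul] at h1
    refine le_of_mul_le_mul_left ?_ hmε0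
    linarith
  -- `ENNReal.ofReal` truncates at `0`, so the sign of the bound is recorded separately; Dirac
  -- directions use only this sign.
  exact ⟨ENNReal.toReal_nonneg.trans hmain, (ENNReal.le_ofReal_iff_toReal_le hXfin
    (ENNReal.toReal_nonneg.trans hmain)).2 hmain⟩

/-- The first variation of the linearised functional in a direction `η`. -/
theorem first_variation {η : Measure (Space n)} (hη : η ∈ FiniteFirstMoment n)
    (hfη : Integrable f η) (hfφη : ∀ᵐ x ∂η, φ x = f x) :
    (0 ≤ (∫⁻ x, (ϱ₀.rnDeriv volume x) ^ (1 / (1 - α))).toReal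
      - α * (∫ x, f x ∂η - ∫ x, f x ∂ϱ₀)) ∧
    ∫⁻ x, η.rnDeriv volume x * (ϱ₀.rnDeriv volume x) ^ (1 / (1 - α) - 1) ≤
      ENNReal.ofReal ((∫⁻ x, (ϱ₀.rnDeriv volume x) ^ (1 / (1 - α))).toReal
      - α * (∫ x, f x ∂η - ∫ x, f x ∂ϱ₀)) := by
  have := hη.1
  -- The shift by `2` keeps `ε k < 1` at `k = 0`.
  let ε : ℕ → ℝ := fun k => 1 / ((k : ℝ) + 2)
  have hε0 : ∀ k, 0 < ε k := fun k => by positivity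
  have hε1 : ∀ k, ε k < 1 := fun k => by
    rw [div_lt_one (by positivity)]; have : (0 : ℝ) ≤ k := k.cast_nonneg; linarith
  have hεlim : Tendsto ε atTop (𝓝 0) := by
    refine Tendsto.div_atTop tendsto_const_nhds ?_
    exact tendsto_atTop_add_const_right _ _ tendsto_natCast_atTop_atTop
  have hstep := fun k => lintegral_mix_le hn hα hα0 hϱ₀ hmin hg hgφ hT hf hfφ hη hfη hfφη
    (hε0 k) (hε1 k)
  have hlim : Tendsto (fun k => (1 - ε k) ^ (1 / (1 - α) - 1) *
      (∫⁻ x, (ϱ₀.rnDeriv volume x) ^ (1 / (1 - α))).toReal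
      - α * (∫ x, f x ∂η - ∫ x, f x ∂ϱ₀)) atTop
      (𝓝 ((∫⁻ x, (ϱ₀.rnDeriv volume x) ^ (1 / (1 - α))).toReal
      - α * (∫ x, f x ∂η - ∫ x, f x ∂ϱ₀))) := by
    have h1 : Tendsto (fun k => 1 - ε k) atTop (𝓝 1) := by
      simpa using tendsto_const_nhds.sub hεlim
    have h2 := h1.rpow_const (p := 1 / (1 - α) - 1) (Or.inl one_ne_zero)
    rw [Real.one_rpow] at h2
    simpa using (h2.mul_const _).sub_const (α * (∫ x, f x ∂η - ∫ x, f x ∂ϱ₀))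
  refine ⟨ge_of_tendsto' hlim fun k => (hstep k).1, ?_⟩
  have hmρ := Measure.measurable_rnDeriv ϱ₀ (volume : Measure (Space n))
  have hmη := Measure.measurable_rnDeriv η (volume : Measure (Space n))
  -- Fatou's lemma. The pointwise limit also holds where the density of `ϱ₀` vanishes, since
  -- `ENNReal` powers are continuous with value `⊤` there.
  calc ∫⁻ x, η.rnDeriv volume x * (ϱ₀.rnDeriv volume x) ^ (1 / (1 - α) - 1)
      = ∫⁻ x, liminf (fun k => η.rnDeriv volume x * (ENNReal.ofReal (1 - ε k) *
          ϱ₀.rnDeriv volume x + ENNReal.ofReal (ε k) * η.rnDeriv volume x) ^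
            (1 / (1 - α) - 1)) atTop := by
        refine lintegral_congr_ae ?_
        have := hϱ₀.1
        filter_upwards [Measure.rnDeriv_lt_top ϱ₀ volume, Measure.rnDeriv_lt_top η volume]
          with x h1 h2
        refine (Tendsto.liminf_eq ?_).symm
        refine ENNReal.Tendsto.const_mul ?_ (Or.inr h2.ne)
        refine (ENNReal.continuous_rpow_const.tendsto _).comp ?_
        have e1 : Tendsto (fun k => ENNReal.ofReal (1 - ε k)) atTop (𝓝 1) := by
          have := (ENNReal.continuous_ofReal.tendsto (1 - 0)).comp
            ((tendsto_const_nhds (x := (1 : ℝ))).sub hεlim)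
          simpa [Function.comp_def] using this
        have e2 : Tendsto (fun k => ENNReal.ofReal (ε k)) atTop (𝓝 0) := by
          simpa [Function.comp_def] using (ENNReal.continuous_ofReal.tendsto 0).comp hεlim
        have e3 := (ENNReal.Tendsto.mul_const e1 (Or.inr h1.ne)).add
          (ENNReal.Tendsto.mul_const e2 (Or.inr h2.ne))
        simpa using e3
    _ ≤ liminf (fun k => ∫⁻ x, η.rnDeriv volume x * (ENNReal.ofReal (1 - ε k) *
          ϱ₀.rnDeriv volume x + ENNReal.ofReal (ε k) * η.rnDeriv volume x) ^
            (1 / (1 - α) - 1)) atTop := lintegral_liminf_le fun k => by fun_prop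
    _ ≤ liminf (fun k => ENNReal.ofReal ((1 - ε k) ^ (1 / (1 - α) - 1) *
        (∫⁻ x, (ϱ₀.rnDeriv volume x) ^ (1 / (1 - α))).toReal
        - α * (∫ x, f x ∂η - ∫ x, f x ∂ϱ₀))) atTop :=
        liminf_le_liminf (Eventually.of_forall fun k => (hstep k).2)
    _ = _ := ((ENNReal.continuous_ofReal.tendsto _).comp hlim).liminf_eq

end minimizer

/-! ### Euler–Lagrange equations -/

theorem one_sub_mul_coe (α a : ℝ) : 1 - (α : EReal) * (a : EReal) = ((1 - α * a : ℝ) : EReal) := by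
  norm_cast

theorem one_sub_mul_top {α : ℝ} (hα0 : α < 0) : 1 - (α : EReal) * ⊤ = ⊤ := by
  rw [EReal.coe_mul_top_of_neg hα0]
  exact EReal.coe_sub_bot 1

theorem ennreal_rpow_eq_mul_rpow_sub_one {x : ENNReal} (h0 : x ≠ 0) (ht : x ≠ ⊤) (m : ℝ) :
    x ^ m = x * x ^ (m - 1) := by
  rw [← add_sub_cancel 1 m, ENNReal.rpow_add _ _ h0 ht, ENNReal.rpow_one, add_sub_cancel_left]

/-- The uniform distribution on a bounded set of positive finite volume. -/
theorem uniform_mem_finiteFirstMoment {B : Set (Space n)} (hB : MeasurableSet B) {R : ℝ}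
    (hR : ∀ x ∈ B, ‖x‖ ≤ R) (h0 : volume B ≠ 0) (h1 : volume B ≠ ⊤) :
    (volume B)⁻¹ • (volume : Measure (Space n)).restrict B ∈ FiniteFirstMoment n := by
  refine ⟨⟨?_⟩, ?_⟩
  · simp [ENNReal.inv_mul_cancel h0 h1]
  · rw [lintegral_smul_measure]
    refine ENNReal.mul_lt_top (ENNReal.inv_lt_top.2 (pos_iff_ne_zero.2 h0)) ?_
    refine (setLIntegral_mono' hB (g := fun _ => ENNReal.ofReal R) fun x hx => ?_).trans_lt ?_
    · rw [← ofReal_norm]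
      exact ENNReal.ofReal_le_ofReal (hR x hx)
    · rw [setLIntegral_const]
      exact ENNReal.mul_lt_top ENNReal.ofReal_lt_top (lt_top_iff_ne_top.2 h1)

section minimizer

variable (hn : 1 ≤ n) {α : ℝ} (hα : -(1 / (n : ℝ)) < α) (hα0 : α < 0)
  {μ ϱ₀ : Measure (Space n)} (hϱ₀ : ϱ₀ ∈ FiniteFirstMoment n)
  (hmin : ∀ ϱ ∈ FiniteFirstMoment n, objective α μ ϱ₀ ≤ objective α μ ϱ)
  {φ : Space n → EReal} {g : Space n → ℝ} (hg : Integrable g μ)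
  (hgφ : ∀ᵐ y ∂μ, legendre φ y = g y)
  (hT : maxCorr ϱ₀ μ = ((∫ x, (φ x).toReal ∂ϱ₀ + ∫ y, g y ∂μ : ℝ) : EReal))
  (hf : Integrable (fun x => (φ x).toReal) ϱ₀) (hfφ : ∀ᵐ x ∂ϱ₀, φ x = (φ x).toReal)
  -- This choice of the additive constant makes the bound of the first variation equal to `∫ (1 - α
  -- φ) dη`.
  (hnorm : α * ∫ x, (φ x).toReal ∂ϱ₀ =
    1 - (∫⁻ x, (ϱ₀.rnDeriv volume x) ^ (1 / (1 - α))).toReal)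
  (hφ : IsConv φ)
include hn hα hα0 hϱ₀ hmin hg hgφ hT hf hfφ hnorm hφ

/-- The normalised optimal potential is bounded below by `1 / α`. -/
theorem one_div_le_potential (x : Space n) : ((1 / α : ℝ) : EReal) ≤ φ x := by
  have hbot := hφ.ne_bot x
  by_cases htop : φ x = ⊤
  · simp [htop]
  have hx : φ x = (φ x).toReal := (EReal.coe_toReal htop hbot).symm
  -- Direction `η = δ_x`, at a point where `φ` is finite.
  have h := (first_variation hn hα hα0 hϱ₀ hmin hg hgφ hT hf hfφ (dirac_mem_finiteFirstMoment x)
    (integrable_dirac (by simp)) (by rw [ae_dirac_eq]; exact hx)).1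
  rw [integral_dirac] at h
  rw [hx, EReal.coe_le_coe_iff, div_le_iff_of_neg hα0]
  linarith

/-- This is the first variation towards the uniform distribution on `B`; `φ` is integrable there
because it lies between `1/α` and `M`. -/
theorem rnDeriv_rpow_le_on {B : Set (Space n)} (hB : MeasurableSet B) {R M : ℝ}
    (hR : ∀ x ∈ B, ‖x‖ ≤ R) (hM : ∀ x ∈ B, φ x ≤ M) :
    ∫⁻ x in B, (ϱ₀.rnDeriv volume x) ^ (1 / (1 - α) - 1) ≤
      ∫⁻ x in B, (1 - (α : EReal) * φ x).toENNReal := by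
  have := hϱ₀.1
  by_cases h0 : volume B = 0
  · rw [Measure.restrict_eq_zero.2 h0]; simp
  have h1 : volume B ≠ ⊤ := by
    refine (Metric.isBounded_iff_subset_closedBall (0 : Space n) |>.2
      ⟨R, fun x hx => ?_⟩).measure_lt_top.ne
    simpa using hR x hx
  have hη := uniform_mem_finiteFirstMoment hB hR h0 h1
  set η : Measure (Space n) := (volume B)⁻¹ • (volume : Measure (Space n)).restrict B with hηdef
  have := hη.1
  have hc0 : (volume B)⁻¹ ≠ 0 := ENNReal.inv_ne_zero.2 h1
  have hct : (volume B)⁻¹ ≠ ⊤ := ENNReal.inv_ne_top.2 h0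
  have hlow := one_div_le_potential hn hα hα0 hϱ₀ hmin hg hgφ hT hf hfφ hnorm hφ
  have hBφ : ∀ x ∈ B, φ x = (φ x).toReal := fun x hx =>
    (EReal.coe_toReal (ne_top_of_le_ne_top (EReal.coe_ne_top M) (hM x hx)) (hφ.ne_bot x)).symm
  have hηB : ∀ᵐ x ∂η, x ∈ B := Measure.ae_smul_measure (ae_restrict_mem hB) _
  have hfη : Integrable (fun x => (φ x).toReal) η := by
    refine Integrable.of_bound hφ.lsc.measurable.ereal_toReal.aestronglyMeasurable
      (max |1 / α| |M|) ?_
    filter_upwards [hηB] with x hx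
    have hl := hlow x
    have hu := hM x hx
    rw [hBφ x hx, EReal.coe_le_coe_iff] at hl hu
    exact abs_le_max_abs_abs hl hu
  have hfv := (first_variation hn hα hα0 hϱ₀ hmin hg hgφ hT hf hfφ hη hfη
    (hηB.mono fun x hx => hBφ x hx)).2
  have hac : η ≪ volume := (Measure.smul_absolutelyContinuous).trans
    Measure.restrict_le_self.absolutelyContinuous
  have hmρ := Measure.measurable_rnDeriv ϱ₀ (volume : Measure (Space n))
  rw [lintegral_rnDeriv_mul hac (by fun_prop)] at hfv
  have e : (∫⁻ x, (ϱ₀.rnDeriv volume x) ^ (1 / (1 - α))).toReal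
      - α * (∫ x, (φ x).toReal ∂η - ∫ x, (φ x).toReal ∂ϱ₀) = ∫ x, (1 - α * (φ x).toReal) ∂η := by
    rw [integral_sub (integrable_const _) (hfη.const_mul α), integral_const_mul]
    simp only [integral_const, probReal_univ, one_smul]
    linarith
  have hpos : ∀ᵐ x ∂η, 0 ≤ 1 - α * (φ x).toReal := by
    filter_upwards [hηB] with x hx
    have hl := hlow x
    rw [hBφ x hx, EReal.coe_le_coe_iff, div_le_iff_of_neg hα0] at hl
    linarith
  have hint : Integrable (fun x => 1 - α * (φ x).toReal) η :=
    (integrable_const _).sub (hfη.const_mul α)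
  rw [e, ofReal_integral_eq_lintegral_ofReal hint hpos,
    hηdef, lintegral_smul_measure, lintegral_smul_measure] at hfv
  refine ((ENNReal.mul_le_mul_iff_right hc0 hct).1 hfv).trans_eq ?_
  refine setLIntegral_congr_fun hB fun x hx => ?_
  rw [hBφ x hx, EReal.toReal_coe, one_sub_mul_coe, EReal.toENNReal_of_ne_top (EReal.coe_ne_top _),
    EReal.toReal_coe]

/-- The bounded sets `D M` exhaust the domain of `φ`, and the integral inequalities on their subsets
give the pointwise one. Outside the domain the right side is `⊤`. -/
theorem rnDeriv_rpow_le : ∀ᵐ x, (ϱ₀.rnDeriv volume x) ^ (1 / (1 - α) - 1) ≤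
    (1 - (α : EReal) * φ x).toENNReal := by
  have hmρ := Measure.measurable_rnDeriv ϱ₀ (volume : Measure (Space n))
  let D : ℕ → Set (Space n) := fun M => {x | ‖x‖ ≤ M ∧ φ x ≤ ((M : ℝ) : EReal)}
  have hD : ∀ M, MeasurableSet (D M) := fun M =>
    (measurableSet_le measurable_norm measurable_const).inter
      (measurableSet_le hφ.lsc.measurable measurable_const)
  have h : ∀ M, ∀ᵐ x ∂((volume : Measure (Space n)).restrict (D M)),
      (ϱ₀.rnDeriv volume x) ^ (1 / (1 - α) - 1) ≤ (1 - (α : EReal) * φ x).toENNReal := by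
    intro M
    refine ae_le_of_forall_setLIntegral_le_of_sigmaFinite (by fun_prop) fun s hs _ => ?_
    rw [Measure.restrict_restrict hs]
    exact rnDeriv_rpow_le_on hn hα hα0 hϱ₀ hmin hg hgφ hT hf hfφ hnorm hφ (hs.inter (hD M))
      (fun x hx => hx.2.1) (fun x hx => hx.2.2)
  have h' : ∀ᵐ x, ∀ M, x ∈ D M →
      (ϱ₀.rnDeriv volume x) ^ (1 / (1 - α) - 1) ≤ (1 - (α : EReal) * φ x).toENNReal :=
    ae_all_iff.2 fun M => (ae_restrict_iff' (hD M)).1 (h M)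
  filter_upwards [h'] with x hx
  by_cases htop : φ x = ⊤
  · rw [htop, one_sub_mul_top hα0]
    simp
  · obtain ⟨M, hM⟩ := exists_nat_ge (max ‖x‖ (φ x).toReal)
    refine hx M ⟨(le_max_left _ _).trans hM, ?_⟩
    rw [← EReal.coe_toReal htop (hφ.ne_bot x), EReal.coe_le_coe_iff]
    exact (le_max_right _ _).trans hM

/-- The Euler–Lagrange equations: the form of the density of a minimiser, and the vanishing of
`1 - α φ` on its singular part. -/
theorem euler_lagrange : (∀ᵐ x, ϱ₀.rnDeriv volume x = density α φ x) ∧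
    ∀ᵐ x ∂(ϱ₀.singularPart volume), (1 - (α : EReal) * φ x).toENNReal = 0 := by
  have := hϱ₀.1
  have hα1 : 0 < 1 - α := by linarith
  have hm0 : 0 < 1 / (1 - α) := by positivity
  have hp : 1 / α - 1 < 0 := by
    have := one_div_neg.2 hα0
    linarith
  have hmp : 1 / (1 - α) - 1 = (1 / α - 1)⁻¹ := by
    have : 1 / α - 1 ≠ 0 := hp.ne
    have := hα0.ne
    field_simp
    ring
  have hE := lintegral_rnDeriv_rpow_lt_top hn hα hα0 hϱ₀
  have hle := rnDeriv_rpow_le hn hα hα0 hϱ₀ hmin hg hgφ hT hf hfφ hnorm hφ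
  have hφm := hφ.lsc.measurable
  have hΨm : Measurable fun x => (1 - (α : EReal) * φ x).toENNReal := by fun_prop
  have hlow := one_div_le_potential hn hα hα0 hϱ₀ hmin hg hgφ hT hf hfφ hnorm hφ
  set Ψ : Space n → ENNReal := fun x => (1 - (α : EReal) * φ x).toENNReal with hΨ
  have hmρ := Measure.measurable_rnDeriv ϱ₀ (volume : Measure (Space n))
  -- The normalisation read on `ϱ₀` itself.
  have hΨint : ∫⁻ x, Ψ x ∂ϱ₀ = ∫⁻ x, (ϱ₀.rnDeriv volume x) ^ (1 / (1 - α)) := by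
    have e : ∫⁻ x, Ψ x ∂ϱ₀ = ∫⁻ x, ENNReal.ofReal (1 - α * (φ x).toReal) ∂ϱ₀ := by
      refine lintegral_congr_ae ?_
      filter_upwards [hfφ] with x hx
      simp only [hΨ]
      rw [hx, EReal.toReal_coe, one_sub_mul_coe, EReal.toENNReal_of_ne_top (EReal.coe_ne_top _),
        EReal.toReal_coe]
    have hpos : ∀ᵐ x ∂ϱ₀, 0 ≤ 1 - α * (φ x).toReal := by
      filter_upwards [hfφ] with x hx
      have hl := hlow x
      rw [hx, EReal.coe_le_coe_iff, div_le_iff_of_neg hα0] at hl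
      linarith
    have hint : Integrable (fun x => 1 - α * (φ x).toReal) ϱ₀ :=
      (integrable_const _).sub (hf.const_mul α)
    rw [e, ← ofReal_integral_eq_lintegral_ofReal hint hpos,
      integral_sub (integrable_const _) (hf.const_mul α), integral_const_mul, hnorm]
    simp only [integral_const, probReal_univ, one_smul, sub_sub_cancel, ENNReal.ofReal_toReal hE.ne]
  have hsplit : ∫⁻ x, Ψ x ∂ϱ₀ = ∫⁻ x, Ψ x ∂(ϱ₀.singularPart volume) +
      ∫⁻ x, ϱ₀.rnDeriv volume x * Ψ x := by
    conv_lhs => rw [Measure.haveLebesgueDecomposition_add ϱ₀ volume]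
    rw [lintegral_add_measure, lintegral_withDensity_eq_lintegral_mul _ hmρ hΨm]
    rfl
  have hmul : ∀ᵐ x, (ϱ₀.rnDeriv volume x) ^ (1 / (1 - α)) ≤ ϱ₀.rnDeriv volume x * Ψ x := by
    filter_upwards [hle, Measure.rnDeriv_lt_top ϱ₀ volume] with x hx htop
    by_cases h0 : ϱ₀.rnDeriv volume x = 0
    · rw [h0, ENNReal.zero_rpow_of_pos hm0]; exact zero_le
    · rw [ennreal_rpow_eq_mul_rpow_sub_one h0 htop.ne]
      gcongr
  have hge := lintegral_mono_ae hmul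
  -- The absolutely continuous part already uses up the whole finite integral of `Ψ`.
  have hsing : ∫⁻ x, Ψ x ∂(ϱ₀.singularPart volume) = 0 := by
    have h1 : ∫⁻ x, Ψ x ∂(ϱ₀.singularPart volume) +
        ∫⁻ x, (ϱ₀.rnDeriv volume x) ^ (1 / (1 - α)) ≤
        0 + ∫⁻ x, (ϱ₀.rnDeriv volume x) ^ (1 / (1 - α)) := by
      rw [zero_add]
      nth_rw 2 [← hΨint]
      rw [hsplit]
      gcongr
    exact le_zero_iff.1 ((ENNReal.add_le_add_iff_right hE.ne).1 h1)
  have heq := ae_eq_of_ae_le_of_lintegral_le hmul hE.ne (hmρ.mul hΨm).aemeasurable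
    (by rw [← hΨint, hsplit]; exact le_add_self)
  refine ⟨?_, (lintegral_eq_zero_iff hΨm).1 hsing⟩
  filter_upwards [hle, heq, Measure.rnDeriv_lt_top ϱ₀ volume] with x hx hxe htop
  change _ = Ψ x ^ (1 / α - 1)
  -- Where the density vanishes, its negative power is `⊤`, which forces `Ψ x = ⊤`; elsewhere the
  -- density cancels from the equality `hxe`.
  by_cases h0 : ϱ₀.rnDeriv volume x = 0
  · rw [h0, ENNReal.zero_rpow_of_neg (by rw [hmp]; exact inv_lt_zero.2 hp), top_le_iff] at hx
    rw [h0, show Ψ x = ⊤ from hx, ENNReal.top_rpow_of_neg hp]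
  · have h1 : (ϱ₀.rnDeriv volume x) ^ (1 / (1 - α)) =
        ϱ₀.rnDeriv volume x * (ϱ₀.rnDeriv volume x) ^ (1 / (1 - α) - 1) :=
      ennreal_rpow_eq_mul_rpow_sub_one h0 htop.ne _
    have h2 : (ϱ₀.rnDeriv volume x) ^ (1 / (1 - α) - 1) = Ψ x :=
      (ENNReal.mul_right_inj h0 htop.ne).1 (h1.symm.trans hxe)
    rw [← h2, hmp, ENNReal.rpow_inv_rpow hp.ne]

end minimizer

end AlphaConcave

end

-- The conditions on the barycenter and on the support of `μ` are what makes a minimiser exist; given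
-- a minimiser `ϱ₀`, its Euler–Lagrange equations do not use them.
theorem mainTheorem6 (n : ℕ) (hn : 1 ≤ n) (α : ℝ) (hα : -(1 / (n : ℝ)) < α) (hα0 : α < 0)
    (μ : Measure (AlphaConcave.Space n)) (hμ : μ ∈ AlphaConcave.FiniteFirstMoment n)
    (hbary : ∫ y, y ∂μ = 0)
    (hplane : ∀ u : AlphaConcave.Space n, u ≠ 0 → ∀ t : ℝ,
      ¬ μ.support ⊆ {y | (inner ℝ u y : ℝ) = t})
    (ϱ₀ : Measure (AlphaConcave.Space n)) (hϱ₀ : ϱ₀ ∈ AlphaConcave.FiniteFirstMoment n)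
    (hmin : ∀ ϱ ∈ AlphaConcave.FiniteFirstMoment n,
      AlphaConcave.objective α μ ϱ₀ ≤ AlphaConcave.objective α μ ϱ) :
    ∃ (φ₀ : AlphaConcave.Space n → EReal) (ϱs : Measure (AlphaConcave.Space n)),
      AlphaConcave.IsConv φ₀ ∧
      (∀ x, ((1 / α : ℝ) : EReal) ≤ φ₀ x) ∧
      ϱ₀ = (volume : Measure (AlphaConcave.Space n)).withDensity
        (AlphaConcave.density α φ₀) + ϱs ∧
      ϱs.MutuallySingular volume ∧
      ϱs.support ⊆ {x | φ₀ x = ((1 / α : ℝ) : EReal)} ∧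
      (∃ a : ℝ, AlphaConcave.eintegral ϱ₀ φ₀ = (a : EReal)) ∧
      (∃ b : ℝ, AlphaConcave.eintegral μ (AlphaConcave.legendre φ₀) = (b : EReal)) ∧
      AlphaConcave.maxCorr ϱ₀ μ = AlphaConcave.eintegral ϱ₀ φ₀ +
        AlphaConcave.eintegral μ (AlphaConcave.legendre φ₀) := by
  open AlphaConcave in
  have := hϱ₀.1
  have hTtop := maxCorr_lt_top_of_minimizer hn hα hα0 hϱ₀ hmin
  obtain ⟨φ, f, g, hφ, hf, hg, hfφ, hgφ, hA, hT⟩ := exists_potential_of_integral hϱ₀ hμ hTtop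
    -- The prescribed integral is the normalisation `hnorm` solved for `∫ φ dϱ₀`.
    ((1 - (∫⁻ x, (ϱ₀.rnDeriv volume x) ^ (1 / (1 - α))).toReal) / α)
  have hff : ∀ᵐ x ∂ϱ₀, f x = (φ x).toReal := by
    filter_upwards [hfφ] with x hx
    rw [hx, EReal.toReal_coe]
  have hint := integral_congr_ae hff
  have hf' : Integrable (fun x => (φ x).toReal) ϱ₀ := hf.congr hff
  have hfφ' : ∀ᵐ x ∂ϱ₀, φ x = (φ x).toReal := by
    filter_upwards [hfφ] with x hx
    rw [hx, EReal.toReal_coe]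
  have hnorm : α * ∫ x, (φ x).toReal ∂ϱ₀ =
      1 - (∫⁻ x, (ϱ₀.rnDeriv volume x) ^ (1 / (1 - α))).toReal := by
    rw [← hint, hA, mul_div_cancel₀ _ hα0.ne]
  have hT' := hT
  rw [hint] at hT'
  have hlow := one_div_le_potential hn hα hα0 hϱ₀ hmin hg hgφ hT' hf' hfφ' hnorm hφ
  obtain ⟨hdens, hsing⟩ := euler_lagrange hn hα hα0 hϱ₀ hmin hg hgφ hT' hf' hfφ' hnorm hφ
  have e1 := eintegral_of_ae_eq_coe hf hfφ
  have e2 := eintegral_of_ae_eq_coe hg hgφ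
  refine ⟨φ, ϱ₀.singularPart volume, hφ, hlow, ?_, Measure.mutuallySingular_singularPart _ _, ?_,
    ⟨_, e1⟩, ⟨_, e2⟩, by rw [hT, e1, e2, EReal.coe_add]⟩
  · rw [← withDensity_congr_ae hdens, add_comm]
    exact Measure.haveLebesgueDecomposition_add ϱ₀ volume
  -- Because `φ ≥ 1/α`, the contact set is a sublevel set, closed by lower semicontinuity; full
  -- measure of it therefore controls the support.
  · have hset : {x | φ x = ((1 / α : ℝ) : EReal)} = φ ⁻¹' Set.Iic ((1 / α : ℝ) : EReal) :=
      Set.ext fun x => ⟨fun h => le_of_eq h, fun h => le_antisymm h (hlow x)⟩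
    rw [hset]
    refine Measure.support_subset_of_isClosed (hφ.lsc.isClosed_preimage _) ?_
    filter_upwards [hsing] with x hx
    rw [EReal.toENNReal_eq_zero_iff] at hx
    by_cases htop : φ x = ⊤
    · rw [htop, one_sub_mul_top hα0] at hx
      simp at hx
    · rw [← EReal.coe_toReal htop (hφ.ne_bot x), one_sub_mul_coe] at hx
      show φ x ≤ _
      rw [← EReal.coe_toReal htop (hφ.ne_bot x), EReal.coe_le_coe_iff, le_div_iff_of_neg hα0]
      have : 1 - α * (φ x).toReal ≤ 0 := by exact_mod_cast hx
      linarith
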